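/- **Theorem (existence of maximizers).** Let $\mathcal L=(L_1,L_2,L_3,L_4)$ be a 4-tuple of linear maps $L_i:\mathbb R^4\to\mathbb R^2$ of the form $$L_i(\mathbf x,\mathbf y)=\big(L_i^1(\mathbf x),L_i^2(\mathbf y)\big),\qquad \mathbf x,\mathbf y\in\mathbb R^2,$$ with $L_i^1,L_i^2:\mathbb R^2\to\mathbb R$ linear and surjective. Assume that $\mathcal L$ is nondegenerate, that is, for all $i\ne j$ in $\{1,2,3,4\}$ the maps $\mathbf x\mapsto(L_i^1(\mathbf x),L_j^1(\mathbf x))$ and $\mathbf y\mapsto(L_i^2(\mathbf y),L_j^2(\mathbf y))$ are bijections from $\mathbb R^2$ to $\mathbb R^2$. For a 4-tuple $\mathbf E=(E_1,E_2,E_3,E_4)$ of Lebesgue measurable subsets of $\mathbb R^2$ write $|\mathbf E|=(|E_1|,|E_2|,|E_3|,|E_4|)$ for the tuple of their Lebesgue measures and put $$\Lambda_{\mathcal L}(\mathbf E)=\int_{\mathbb R^4}\prod_{i=1}^4\mathbf 1_{E_i}\big(L_i(\mathbf x,\mathbf y)\big)\,d\mathbf x\,d\mathbf y,$$ and for $\mathbf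 e\in(0,\infty)^4$ put $$\Theta(\mathbf e)=\sup\{\Lambda_{\mathcal L}(\mathbf E): |\mathbf E|=\mathbf e\}.$$ Then for every $\mathbf e\in(0,\infty)^4$ the supremum $\Theta(\mathbf e)$ is finite, and there exists a 4-tuple $\mathbf E$ of Lebesgue measurable subsets of $\mathbb R^2$ with $|\mathbf E|=\mathbf e$ and $\Lambda_{\mathcal L}(\mathbf E)=\Theta(\mathbf e)$. -/

import Mathlib

open MeasureTheory
open scoped ENNReal

namespace PartialSymm

/-- The plane `ℝ²`; its `volume` is Lebesgue measure. -/
abbrev Plane : Type := ℝ × ℝ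

/-- The space `ℝ⁴` with coordinates `(𝐱, 𝐲) = ((x₁, x₂), (y₁, y₂))`; its `volume` is
Lebesgue measure. -/
abbrev Space4 : Type := Plane × Plane

/-- A 4-tuple of linear maps `L_i : ℝ⁴ → ℝ²`. -/
abbrev Tuple : Type := Fin 4 → (Space4 →ₗ[ℝ] Plane)

/-- The partial symmetry hypothesis: each `L_i` has the form
`L_i(𝐱, 𝐲) = (L_i¹(𝐱), L_i²(𝐲))` with `L_i¹, L_i² : ℝ² → ℝ` linear and surjective. -/
def PartialSymmetry (L : Tuple) : Prop :=
  ∀ i, ∃ A B : Plane →ₗ[ℝ] ℝ, Function.Surjective A ∧ Function.Surjective B ∧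
    ∀ x y : Plane, L i (x, y) = (A x, B y)

/-- The component `L_i¹`, i.e. `𝐱 ↦` first coordinate of `L_i(𝐱, 0)`. -/
def comp1 (L : Tuple) (i : Fin 4) : Plane →ₗ[ℝ] ℝ :=
  LinearMap.fst ℝ ℝ ℝ ∘ₗ L i ∘ₗ LinearMap.inl ℝ Plane Plane

/-- The component `L_i²`, i.e. `𝐲 ↦` second coordinate of `L_i(0, 𝐲)`. -/
def comp2 (L : Tuple) (i : Fin 4) : Plane →ₗ[ℝ] ℝ :=
  LinearMap.snd ℝ ℝ ℝ ∘ₗ L i ∘ₗ LinearMap.inr ℝ Plane Plane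

/-- The components in the partial symmetry hypothesis are uniquely determined: they are
`comp1` and `comp2`. -/
theorem comp_eq {L : Tuple} {i : Fin 4} {A B : Plane →ₗ[ℝ] ℝ}
    (h : ∀ x y : Plane, L i (x, y) = (A x, B y)) : comp1 L i = A ∧ comp2 L i = B := by
  constructor <;> apply LinearMap.ext <;> intro z
  · simp [comp1, h]
  · simp [comp2, h]

/-- Nondegeneracy (of a tuple with the partial symmetry): for all `i ≠ j` the maps
`𝐱 ↦ (L_i¹(𝐱), L_j¹(𝐱))` and `𝐲 ↦ (L_i²(𝐲), L_j²(𝐲))` are bijections of `ℝ²`. -/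
def Nondegenerate (L : Tuple) : Prop :=
  ∀ i j, i ≠ j →
    Function.Bijective (fun x : Plane => ((comp1 L i x, comp1 L j x) : Plane)) ∧
    Function.Bijective (fun y : Plane => ((comp2 L i y, comp2 L j y) : Plane))

/-- `Λ_L(𝐄) = ∫_{ℝ⁴} ∏ i, 1_{E_i}(L_i(𝐱, 𝐲)) d𝐱 d𝐲`, as an element of `[0, ∞]`. -/
noncomputable def Lam (L : Tuple) (E : Fin 4 → Set Plane) : ℝ≥0∞ :=
  ∫⁻ z : Space4, ∏ i, (E i).indicator (fun _ => (1 : ℝ≥0∞)) (L i z)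

/-- `𝐄` is a 4-tuple of Lebesgue measurable subsets of `ℝ²` with `|𝐄| = 𝐞`. -/
def HasMeasures (E : Fin 4 → Set Plane) (e : Fin 4 → ℝ) : Prop :=
  ∀ i, NullMeasurableSet (E i) volume ∧ volume (E i) = ENNReal.ofReal (e i)

/-- `Θ_L(𝐞)`, the supremum of `Λ_L(𝐄)` over all `𝐄` with `|𝐄| = 𝐞`, in `[0, ∞]`. -/
noncomputable def Theta (L : Tuple) (e : Fin 4 → ℝ) : ℝ≥0∞ :=
  ⨆ (E : Fin 4 → Set Plane) (_ : HasMeasures E e), Lam L E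

end PartialSymm

namespace PartialSymm

open Set Filter Topology

/-- One-dimensional Brunn–Minkowski inequality. -/
theorem volume_add_volume_le_of_add_mem {S T H : Set ℝ} (hS : MeasurableSet S)
    (hT : MeasurableSet T) (hSn : S.Nonempty) (hTn : T.Nonempty)
    (h : ∀ s ∈ S, ∀ t ∈ T, s + t ∈ H) : volume S + volume T ≤ volume H := by
  have key : ∀ S' T' : Set ℝ, IsCompact S' → IsCompact T' → S'.Nonempty → T'.Nonempty →
      S' ⊆ S → T' ⊆ T → volume S' + volume T' ≤ volume H := by
    intro S' T' hS' hT' hSn' hTn' hSS hTT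
    obtain ⟨s, hs, hsm⟩ := hS'.exists_isGreatest hSn'
    obtain ⟨t, ht, htm⟩ := hT'.exists_isLeast hTn'
    have e1 : volume ((fun x => x + (-t)) ⁻¹' S') = volume S' := measure_preimage_add_right _ _ _
    have e2 : volume ((fun x => (-s) + x) ⁻¹' T') = volume T' := measure_preimage_add _ _ _
    rw [← e1, ← e2, ← measure_union₀]
    · apply measure_mono
      rintro x (hx | hx)
      · have := h _ (hSS hx) _ (hTT ht)
        simpa using this
      · have := h _ (hSS hs) _ (hTT hx)
        simpa using this
    · exact ((measurable_const_add (-s)) hT'.measurableSet).nullMeasurableSet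
    · refine measure_mono_null (t := {s + t}) ?_ (by simp)
      rintro x ⟨hx, hx'⟩
      have a1 := hsm hx
      have a2 := htm hx'
      simp only [mem_singleton_iff]
      linarith
  obtain ⟨s, hs⟩ := hSn
  obtain ⟨t, ht⟩ := hTn
  rw [hS.measure_eq_iSup_isCompact, hT.measure_eq_iSup_isCompact]
  simp only [iSup_and']
  refine ENNReal.biSup_add_biSup_le' ⟨∅, by simp⟩ ⟨∅, by simp⟩ ?_
  rintro S' ⟨hS1, hS2⟩ T' ⟨hT1, hT2⟩
  refine le_trans (add_le_add (measure_mono (subset_insert s S'))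
    (measure_mono (subset_insert t T'))) (key _ _ (hS2.insert s) (hT2.insert t)
      (insert_nonempty _ _) (insert_nonempty _ _) ?_ ?_)
  · exact insert_subset hs hS1
  · exact insert_subset ht hT1

theorem lintegral_comp_affine (f : ℝ → ℝ≥0∞) {a : ℝ} (ha : 0 < a) (b : ℝ) :
    ∫⁻ x, f x = ENNReal.ofReal a * ∫⁻ x, f (a * x + b) := by
  have h1 : ∫⁻ x, f (a * x + b) = ∫⁻ x, f (x + b) ∂(Measure.map (a * ·) volume) :=
    (lintegral_map_equiv (fun x => f (x + b)) (MeasurableEquiv.mulLeft₀ a ha.ne')).symm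
  have h2 := Real.smul_map_volume_mul_left ha.ne'
  rw [abs_of_pos ha] at h2
  rw [h1, ← smul_eq_mul, ← lintegral_smul_measure, h2, lintegral_add_right_eq_self]

theorem volume_plane_eq {K : Set Plane} (hK : MeasurableSet K) :
    volume K = ∫⁻ p : ℝ, volume {q : ℝ | (p, q) ∈ K} :=
  Measure.prod_apply hK

/-- A linear form of the planar Brunn–Minkowski inequality, proved by matching vertical slices. -/
theorem volume_add_volume_le_of_fiber {K K' H : Set Plane} (hK : MeasurableSet K)
    (hK' : MeasurableSet K') (hH : MeasurableSet H) {a b a' b' θ : ℝ} (hθ : 0 < θ)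
    (hab : b' - a' = θ * (b - a))
    (hp : ∀ p, (∃ q, (p, q) ∈ K) ↔ a < p ∧ p < b)
    (hp' : ∀ p, (∃ q, (p, q) ∈ K') ↔ a' < p ∧ p < b')
    (h : ∀ x ∈ K, ∀ y ∈ K', x + y ∈ H) :
    ENNReal.ofReal (1 + θ) * volume K + ENNReal.ofReal ((1 + θ) / θ) * volume K' ≤ volume H := by
  rw [volume_plane_eq hK, volume_plane_eq hK', volume_plane_eq hH]
  rw [lintegral_comp_affine (fun p => volume {q : ℝ | (p, q) ∈ K'}) hθ (a' - θ * a),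
    lintegral_comp_affine (fun p => volume {q : ℝ | (p, q) ∈ H}) (a := 1 + θ) (by linarith)
      (a' - θ * a), ← mul_assoc, ← ENNReal.ofReal_mul (by positivity),
      div_mul_cancel₀ _ hθ.ne', ← mul_add,
      ← lintegral_add_left (f := fun p => volume {q : ℝ | (p, q) ∈ K})
        (measurable_measure_prodMk_left hK)]
  gcongr with p
  by_cases hpp : a < p ∧ p < b
  · have h2 : a' < θ * p + (a' - θ * a) ∧ θ * p + (a' - θ * a) < b' := by
      constructor <;> nlinarith
    refine volume_add_volume_le_of_add_mem (hK.preimage measurable_prodMk_left)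
      (hK'.preimage measurable_prodMk_left) ((hp p).2 hpp) ((hp' _).2 h2) ?_
    intro s hs t ht
    have := h _ hs _ ht
    simp only [Prod.mk_add_mk] at this
    rw [mem_ofPred_eq, show (1 + θ) * p + (a' - θ * a) = p + (θ * p + (a' - θ * a)) by ring]
    exact this
  · have h1 : {q : ℝ | (p, q) ∈ K} = ∅ := by
      rw [eq_empty_iff_forall_notMem]
      exact fun q hq => hpp ((hp p).1 ⟨q, hq⟩)
    have h2 : {q : ℝ | (θ * p + (a' - θ * a), q) ∈ K'} = ∅ := by
      rw [eq_empty_iff_forall_notMem]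
      intro q hq
      have := (hp' _).1 ⟨q, hq⟩
      exact hpp ⟨by nlinarith, by nlinarith⟩
    rw [h1, h2]; simp

theorem exists_fiber_bounds {K : Set Plane} (hKo : IsOpen K) (hKc : Convex ℝ K)
    (hKb : Bornology.IsBounded K) (hKn : K.Nonempty) :
    ∃ a b : ℝ, a < b ∧ ∀ p, (∃ q, (p, q) ∈ K) ↔ a < p ∧ p < b := by
  set P : Set ℝ := Prod.fst '' K with hP
  have hPo : IsOpen P := isOpenMap_fst K hKo
  have hPc : IsPreconnected P := (hKc.isPreconnected).image _ continuous_fst.continuousOn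
  have hPb : Bornology.IsBounded P := by
    obtain ⟨R, hR⟩ := hKb.exists_norm_le
    refine isBounded_iff_forall_norm_le.2 ⟨R, ?_⟩
    rintro _ ⟨x, hx, rfl⟩
    exact (norm_fst_le x).trans (hR x hx)
  have hPn : P.Nonempty := hKn.image _
  have hsub : Ioo (sInf P) (sSup P) ⊆ P :=
    IsConnected.Ioo_csInf_csSup_subset ⟨hPn, hPc⟩ hPb.bddBelow hPb.bddAbove
  have hmem : ∀ p ∈ P, sInf P < p ∧ p < sSup P := by
    intro p hp
    obtain ⟨ε, hε, hball⟩ := Metric.isOpen_iff.1 hPo p hp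
    have h1 : p - ε / 2 ∈ P := hball (by simp [abs_of_pos hε]; linarith)
    have h2 : p + ε / 2 ∈ P := hball (by simp [abs_of_pos hε]; linarith)
    have h3 := csInf_le hPb.bddBelow h1
    have h4 := le_csSup hPb.bddAbove h2
    constructor <;> linarith
  refine ⟨sInf P, sSup P, ?_, fun p => ⟨?_, fun h => ?_⟩⟩
  · obtain ⟨p, hp⟩ := hPn
    exact (hmem p hp).1.trans (hmem p hp).2
  · rintro ⟨q, hq⟩
    exact hmem p ⟨(p, q), hq, rfl⟩
  · obtain ⟨⟨p', q⟩, hx, rfl⟩ := hsub h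
    exact ⟨q, hx⟩

/-- A `4`-tuple of linear forms on the plane. -/
abbrev Forms : Type := Fin 4 → (Plane →ₗ[ℝ] ℝ)

/-- Any two of the forms are coordinates on the plane. -/
def Transversal (A : Forms) : Prop :=
  ∀ i j, i ≠ j → Function.Bijective (fun x : Plane => ((A i x, A j x) : Plane))

/-- The intersection of the strips `|A i x - c i| < r i`. -/
def strips (A : Forms) (c r : Fin 4 → ℝ) : Set Plane := {x | ∀ i, |A i x - c i| < r i}

theorem continuous_form (f : Plane →ₗ[ℝ] ℝ) : Continuous f :=
  f.continuous_of_finiteDimensional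

theorem measurable_form (f : Plane →ₗ[ℝ] ℝ) : Measurable f := (continuous_form f).measurable

theorem isOpen_strips (A : Forms) (c r : Fin 4 → ℝ) : IsOpen (strips A c r) := by
  have : strips A c r = ⋂ i, {x | |A i x - c i| < r i} := by ext; simp [strips]
  rw [this]
  refine isOpen_iInter_of_finite fun i => isOpen_lt ?_ continuous_const
  exact ((continuous_form (A i)).sub continuous_const).abs

theorem convex_strips (A : Forms) (c r : Fin 4 → ℝ) : Convex ℝ (strips A c r) := by
  have : strips A c r = ⋂ i, (A i) ⁻¹' (Metric.ball (c i) (r i)) := by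
    ext; simp [strips, Real.dist_eq]
  rw [this]
  exact convex_iInter fun i => (convex_ball _ _).linear_preimage (A i)

theorem exists_norm_le_of_bijective {f g : Plane →ₗ[ℝ] ℝ}
    (h : Function.Bijective (fun x : Plane => ((f x, g x) : Plane))) :
    ∃ C > 0, ∀ x : Plane, ‖x‖ ≤ C * max |f x| |g x| := by
  let e : Plane ≃ₗ[ℝ] Plane := LinearEquiv.ofBijective (f.prod g) h
  let e' : Plane →L[ℝ] Plane := LinearMap.toContinuousLinearMap (e.symm : Plane →ₗ[ℝ] Plane)
  refine ⟨‖e'‖ + 1, by positivity, fun x => ?_⟩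
  have h1 : e' (f x, g x) = x := e.symm_apply_apply x
  calc ‖x‖ = ‖e' (f x, g x)‖ := by rw [h1]
    _ ≤ ‖e'‖ * ‖((f x, g x) : Plane)‖ := e'.le_opNorm _
    _ ≤ (‖e'‖ + 1) * max |f x| |g x| := by
      have : ‖((f x, g x) : Plane)‖ = max |f x| |g x| := by simp [Prod.norm_def]
      rw [this]
      gcongr
      linarith

theorem isBounded_strips {A : Forms} (hA : Transversal A) (c r : Fin 4 → ℝ) :
    Bornology.IsBounded (strips A c r) := by
  obtain ⟨C, hC, h⟩ := exists_norm_le_of_bijective (hA 0 1 (by decide))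
  refine isBounded_iff_forall_norm_le.2 ⟨C * max (r 0 + |c 0|) (r 1 + |c 1|), fun x hx => ?_⟩
  refine (h x).trans ?_
  have key : ∀ i, |A i x| ≤ r i + |c i| := fun i => by
    have h1 := hx i
    have h2 := abs_sub_abs_le_abs_sub (A i x) (c i)
    linarith
  gcongr <;> apply key

theorem volume_strips_lt_top {A : Forms} (hA : Transversal A) (c r : Fin 4 → ℝ) :
    volume (strips A c r) < ∞ := (isBounded_strips hA c r).measure_lt_top

theorem mem_strips_neg {A : Forms} {c r : Fin 4 → ℝ} {x : Plane} :
    -x ∈ strips A (-c) r ↔ x ∈ strips A c r := by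
  refine forall_congr' fun i => ?_
  rw [map_neg, Pi.neg_apply, ← abs_neg]
  ring_nf

theorem mem_strips_smul {A : Forms} {c r : Fin 4 → ℝ} {x : Plane} {s : ℝ} (hs : 0 < s) :
    s • x ∈ strips A (s • c) (s • r) ↔ x ∈ strips A c r := by
  refine forall_congr' fun i => ?_
  simp only [map_smul, Pi.smul_apply, smul_eq_mul]
  rw [← mul_sub, abs_mul, abs_of_pos hs, mul_lt_mul_iff_right₀ hs]

theorem volume_strips_neg (A : Forms) (c r : Fin 4 → ℝ) :
    volume (strips A (-c) r) = volume (strips A c r) := by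
  rw [← Measure.measure_preimage_neg volume (strips A (-c) r)]
  congr 1
  ext x
  exact mem_strips_neg

theorem volume_strips_smul (A : Forms) (c r : Fin 4 → ℝ) {s : ℝ} (hs : 0 < s) :
    volume (strips A (s • c) (s • r)) = ENNReal.ofReal (s ^ 2) * volume (strips A c r) := by
  have h := Measure.addHaar_preimage_smul (volume : Measure Plane) hs.ne'
    (strips A (s • c) (s • r))
  have h2 : (fun x : Plane => s • x) ⁻¹' (strips A (s • c) (s • r)) = strips A c r := by
    ext x
    exact mem_strips_smul hs
  rw [h2] at h
  simp only [Module.finrank_prod, Module.finrank_self] at h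
  rw [h, ← mul_assoc, ← ENNReal.ofReal_mul (by positivity), abs_of_pos (by positivity)]
  norm_num
  rw [mul_inv_cancel₀ (by positivity)]
  simp

theorem add_mem_strips {A : Forms} {c c' r r' : Fin 4 → ℝ} {x y : Plane} (hx : x ∈ strips A c r)
    (hy : y ∈ strips A c' r') : x + y ∈ strips A (c + c') (r + r') := by
  intro i
  have h1 := hx i
  have h2 := hy i
  simp only [map_add, Pi.add_apply]
  rw [abs_lt] at *
  constructor <;> linarith

/-- Anderson's inequality for intersections of strips. -/
theorem volume_strips_le_smul {A : Forms} (hA : Transversal A) (c r : Fin 4 → ℝ) {t : ℝ}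
    (ht0 : 0 ≤ t) (ht1 : t ≤ 1) : volume (strips A c r) ≤ volume (strips A (t • c) r) := by
  rcases ht1.eq_or_lt with rfl | ht1
  · simp
  rcases (strips A c r).eq_empty_or_nonempty with h0 | hne
  · simp [h0]
  obtain ⟨a, b, hab, hfib⟩ := exists_fiber_bounds (isOpen_strips A c r) (convex_strips A c r)
    (isBounded_strips hA c r) hne
  set l := (1 + t) / 2 with hl
  set m := (1 - t) / 2 with hm
  have hl0 : 0 < l := by positivity
  have hm0 : 0 < m := by rw [hm]; linarith
  have hlm : l + m = 1 := by rw [hl, hm]; ring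
  have key := volume_add_volume_le_of_fiber (K := strips A (l • c) (l • r))
    (K' := strips A (m • (-c)) (m • r)) (H := strips A (t • c) r)
    (isOpen_strips _ _ _).measurableSet (isOpen_strips _ _ _).measurableSet
    (isOpen_strips _ _ _).measurableSet (a := l * a) (b := l * b) (a' := -(m * b)) (b' := -(m * a))
    (θ := m / l) (by positivity) (by field_simp; ring) ?_ ?_ ?_
  · rw [volume_strips_smul A _ _ hl0, volume_strips_smul A _ _ hm0, volume_strips_neg, ← mul_assoc,
      ← mul_assoc, ← add_mul, ← ENNReal.ofReal_mul (by positivity),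
      ← ENNReal.ofReal_mul (by positivity), ← ENNReal.ofReal_add (by positivity) (by positivity)]
      at key
    have e : (1 + m / l) * l ^ 2 + (1 + m / l) / (m / l) * m ^ 2 = 1 := by
      field_simp
      have : m = 1 - l := by linarith
      rw [this]; ring
    rwa [e, ENNReal.ofReal_one, one_mul] at key
  · intro p
    rw [← mul_lt_mul_iff_right₀ (inv_pos.2 hl0), ← mul_lt_mul_iff_right₀ (inv_pos.2 hl0) (b := p),
      inv_mul_cancel_left₀ hl0.ne', inv_mul_cancel_left₀ hl0.ne', ← hfib]
    constructor
    · rintro ⟨q, hq⟩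
      refine ⟨l⁻¹ * q, ?_⟩
      rw [← mem_strips_smul hl0]
      simpa [hl0.ne'] using hq
    · rintro ⟨q, hq⟩
      refine ⟨l * q, ?_⟩
      rw [← mem_strips_smul hl0] at hq
      simpa [hl0.ne'] using hq
  · intro p
    have e : (-(m * b) < p ∧ p < -(m * a)) ↔ (a < -(m⁻¹ * p) ∧ -(m⁻¹ * p) < b) := by
      rw [← mul_lt_mul_iff_right₀ hm0 (b := a), ← mul_lt_mul_iff_right₀ hm0 (c := b)]
      have : m * (-(m⁻¹ * p)) = -p := by field_simp
      rw [this]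
      constructor <;> rintro ⟨h1, h2⟩ <;> constructor <;> linarith
    rw [e, ← hfib]
    constructor
    · rintro ⟨q, hq⟩
      refine ⟨-(m⁻¹ * q), ?_⟩
      rw [← mem_strips_neg, ← mem_strips_smul hm0]
      simpa [hm0.ne'] using hq
    · rintro ⟨q, hq⟩
      refine ⟨-(m * q), ?_⟩
      rw [← mem_strips_neg, ← mem_strips_smul hm0] at hq
      simpa [hm0.ne'] using hq
  · intro x hx y hy
    have := add_mem_strips hx hy
    have e1 : t • c = l • c + m • (-c) := by
      ext i
      simp only [Pi.smul_apply, Pi.add_apply, Pi.neg_apply, smul_eq_mul, hl, hm]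
      ring
    have e2 : l • r + m • r = r := by rw [← add_smul, hlm, one_smul]
    rwa [← e1, e2] at this

theorem volume_strips_zero_pos (A : Forms) {r : Fin 4 → ℝ} (hr : ∀ i, 0 < r i) :
    0 < volume (strips A 0 r) := by
  refine (isOpen_strips A 0 r).measure_pos volume ⟨0, fun i => ?_⟩
  simpa using hr i

theorem volume_strips_add_lt {A : Forms} (hA : Transversal A) {r s : Fin 4 → ℝ}
    (hr : ∀ i, 0 < r i) (hs : ∀ i, 0 < s i) :
    volume (strips A 0 r) + volume (strips A 0 s) < volume (strips A 0 (r + s)) := by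
  have hne : ∀ r : Fin 4 → ℝ, (∀ i, 0 < r i) → (strips A 0 r).Nonempty := fun r hr =>
    ⟨0, fun i => by simpa using hr i⟩
  obtain ⟨a, b, hab, hfib⟩ := exists_fiber_bounds (isOpen_strips A 0 r) (convex_strips A 0 r)
    (isBounded_strips hA 0 r) (hne r hr)
  obtain ⟨a', b', hab', hfib'⟩ := exists_fiber_bounds (isOpen_strips A 0 s) (convex_strips A 0 s)
    (isBounded_strips hA 0 s) (hne s hs)
  have hb : 0 < b - a := sub_pos.2 hab
  have hb' : 0 < b' - a' := sub_pos.2 hab'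
  have hθ : 0 < (b' - a') / (b - a) := by positivity
  refine lt_of_lt_of_le ?_ (volume_add_volume_le_of_fiber (H := strips A 0 (r + s))
    (isOpen_strips _ _ _).measurableSet (isOpen_strips _ _ _).measurableSet
    (isOpen_strips _ _ _).measurableSet hθ (by field_simp) hfib hfib' ?_)
  · have h1 := volume_strips_zero_pos A hr
    have h2 := volume_strips_zero_pos A hs
    have f1 := (volume_strips_lt_top hA 0 r).ne
    have f2 := (volume_strips_lt_top hA 0 s).ne
    refine ENNReal.add_lt_add ?_ ?_
    · conv_lhs => rw [← one_mul (volume (strips A 0 r))]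
      refine (ENNReal.mul_lt_mul_iff_left h1.ne' f1).2 ?_
      rw [← ENNReal.ofReal_one, ENNReal.ofReal_lt_ofReal_iff (by positivity)]
      linarith
    · conv_lhs => rw [← one_mul (volume (strips A 0 s))]
      refine (ENNReal.mul_lt_mul_iff_left h2.ne' f2).2 ?_
      rw [← ENNReal.ofReal_one, ENNReal.ofReal_lt_ofReal_iff (by positivity), lt_div_iff₀ hθ]
      linarith
  · intro x hx y hy
    simpa using add_mem_strips hx hy

/-- The area of the set of points `x` with `|A i x| < r i` for all `i`. -/
noncomputable def stripVolume (A : Forms) (r : Fin 4 → ℝ≥0∞) : ℝ≥0∞ :=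
  volume {x : Plane | ∀ i, ENNReal.ofReal |A i x| < r i}

theorem stripVolume_ofReal (A : Forms) (r : Fin 4 → ℝ) :
    stripVolume A (fun i => ENNReal.ofReal (r i)) = volume (strips A 0 r) := by
  rw [stripVolume, strips]
  congr 1
  ext x
  refine forall_congr' fun i => ?_
  rw [ENNReal.ofReal_lt_ofReal_iff', Pi.zero_apply, sub_zero]
  exact ⟨fun h => h.1, fun h => ⟨h, (abs_nonneg _).trans_lt h⟩⟩

theorem stripVolume_mono (A : Forms) {r s : Fin 4 → ℝ≥0∞} (h : ∀ i, r i ≤ s i) :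
    stripVolume A r ≤ stripVolume A s :=
  measure_mono fun _ hx i => (hx i).trans_le (h i)

/-- The indicator of the open interval with centre `c` and radius `r`. -/
noncomputable def bump (c r u : ℝ) : ℝ≥0∞ := if |u - c| < r then 1 else 0

theorem measurable_bump (c r : ℝ) : Measurable (bump c r) :=
  Measurable.ite (measurableSet_lt (by fun_prop) measurable_const) measurable_const
    measurable_const

theorem lintegral_prod_bump (A : Forms) (c r : Fin 4 → ℝ) :
    ∫⁻ x : Plane, ∏ i, bump (c i) (r i) (A i x) = volume (strips A c r) := by
  rw [← lintegral_indicator_one (isOpen_strips A c r).measurableSet]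
  congr 1
  ext x
  simp only [bump]
  rw [Finset.prod_ite_zero]
  simp only [Finset.mem_univ, forall_const, Finset.prod_const_one, indicator, strips,
    mem_ofPred_eq, Pi.one_apply]
  congr

theorem lintegral_prod_sum_bump (A : Forms) (S : Fin 4 → Finset ℕ) (c r : Fin 4 → ℕ → ℝ) :
    ∫⁻ x : Plane, ∏ i, ∑ j ∈ S i, bump (c i j) (r i j) (A i x) =
      ∑ p ∈ Fintype.piFinset S, volume (strips A (fun i => c i (p i)) (fun i => r i (p i))) := by
  simp_rw [Finset.prod_univ_sum]
  rw [lintegral_finsetSum]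
  · simp_rw [← lintegral_prod_bump]
  · intro p _
    exact Finset.measurable_prod _ fun i _ => (measurable_bump _ _).comp (measurable_form (A i))

theorem lintegral_prod_sum_bump_le_smul {A : Forms} (hA : Transversal A) (S : Fin 4 → Finset ℕ)
    (c r : Fin 4 → ℕ → ℝ) {t : ℝ} (ht0 : 0 ≤ t) (ht1 : t ≤ 1) :
    ∫⁻ x : Plane, ∏ i, ∑ j ∈ S i, bump (c i j) (r i j) (A i x) ≤
      ∫⁻ x : Plane, ∏ i, ∑ j ∈ S i, bump (t * c i j) (r i j) (A i x) := by
  rw [lintegral_prod_sum_bump, lintegral_prod_sum_bump A S (fun i j => t * c i j) r]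
  exact Finset.sum_le_sum fun p _ => volume_strips_le_smul hA _ _ ht0 ht1

/-- Two adjacent intervals of a disjoint family can be merged. -/
theorem exists_merge {S : Finset ℕ} {c r : ℕ → ℝ} (hr : ∀ j ∈ S, 0 < r j)
    (hd : ∀ j ∈ S, ∀ k ∈ S, j ≠ k → r j + r k ≤ |c j - c k|) {j k : ℕ} (hj : j ∈ S) (hk : k ∈ S)
    (hjk : c j < c k) (ht : c k - c j = r j + r k) :
    ∃ (S' : Finset ℕ) (c' r' : ℕ → ℝ), S'.card + 1 = S.card ∧ (∀ j ∈ S', 0 < r' j) ∧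
      (∀ j ∈ S', ∀ k ∈ S', j ≠ k → r' j + r' k ≤ |c' j - c' k|) ∧
      ∑ j ∈ S', r' j = ∑ j ∈ S, r j ∧
      ∀ u, ∑ j ∈ S, bump (c j) (r j) u ≤ ∑ j ∈ S', bump (c' j) (r' j) u := by
  have hne : j ≠ k := by rintro rfl; exact lt_irrefl _ hjk
  have hjT : j ∈ S.erase k := Finset.mem_erase.2 ⟨hne, hj⟩
  set d := (c j - r j + (c k + r k)) / 2 with hd'
  refine ⟨S.erase k, Function.update c j d, Function.update r j (r j + r k),
    Finset.card_erase_add_one hk, ?_, ?_, ?_, ?_⟩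
  · intro l hl
    rcases eq_or_ne l j with rfl | hlj
    · simpa using add_pos (hr _ hj) (hr _ hk)
    · simpa [hlj] using hr l (Finset.mem_of_mem_erase hl)
  · have key : ∀ l ∈ S.erase k, l ≠ j → r j + r k + r l ≤ |d - c l| := by
      intro l hl hlj
      have hlS := Finset.mem_of_mem_erase hl
      have hlk := Finset.ne_of_mem_erase hl
      have h1 := hd l hlS j hj hlj
      have h2 := hd l hlS k hk hlk
      have h3 := hr l hlS
      have h4 := hr j hj
      have h5 := hr k hk
      rcases le_total (c l) (c j) with h | h
      · rw [abs_of_nonpos (by linarith)] at h1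
        rw [abs_of_nonneg (by rw [hd']; linarith), hd']
        linarith
      · rw [abs_of_nonneg (by linarith)] at h1
        rcases le_total (c l) (c k) with h' | h'
        · rw [abs_of_nonpos (by linarith)] at h2
          linarith
        · rw [abs_of_nonneg (by linarith)] at h2
          rw [abs_of_nonpos (by rw [hd']; linarith), hd']
          linarith
    intro l hl m hm hlm
    rcases eq_or_ne l j with rfl | hlj
    · simpa [hlm.symm] using key m hm hlm.symm
    · rcases eq_or_ne m j with rfl | hmj
      · rw [abs_sub_comm]
        simpa [hlj, add_comm] using key l hl hlj
      · simpa [hlj, hmj] using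
          hd l (Finset.mem_of_mem_erase hl) m (Finset.mem_of_mem_erase hm) hlm
  · rw [← Finset.add_sum_erase S r hk, ← Finset.add_sum_erase _ _ hjT,
      ← Finset.add_sum_erase _ r hjT, Function.update_self]
    have : ∑ x ∈ (S.erase k).erase j, Function.update r j (r j + r k) x =
        ∑ x ∈ (S.erase k).erase j, r x :=
      Finset.sum_congr rfl fun l hl => by rw [Function.update_of_ne (Finset.ne_of_mem_erase hl)]
    rw [this]
    ring
  · intro u
    rw [← Finset.add_sum_erase S _ hk, ← Finset.add_sum_erase _ _ hjT, ← add_assoc,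
      ← Finset.add_sum_erase _ (fun l => bump (Function.update c j d l) _ u) hjT]
    simp only [Function.update_self]
    refine add_le_add ?_ (le_of_eq ?_)
    · have h4 := hr j hj
      have h5 := hr k hk
      unfold bump
      by_cases h1 : |u - c k| < r k
      · have h2 : ¬ |u - c j| < r j := by
          rw [abs_lt] at h1 ⊢
          intro h2
          linarith [h1.1, h2.2]
        have h3 : |u - d| < r j + r k := by
          rw [abs_lt] at h1 ⊢
          constructor <;> linarith [h1.1, h1.2]
        simp [h1, h2, h3]
      · by_cases h2 : |u - c j| < r j
        · have h3 : |u - d| < r j + r k := by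
            rw [abs_lt] at h2 ⊢
            constructor <;> linarith [h2.1, h2.2]
          simp [h1, h2, h3]
        · simp [h1, h2]
    · refine Finset.sum_congr rfl fun l hl => ?_
      rw [Function.update_of_ne (Finset.ne_of_mem_erase hl),
        Function.update_of_ne (Finset.ne_of_mem_erase hl)]

/-- The Brascamp–Lieb–Luttinger inequality for finite unions of intervals. -/
theorem lintegral_prod_sum_bump_le {A : Forms} (hA : Transversal A) (n : ℕ) :
    ∀ (S : Fin 4 → Finset ℕ) (c r : Fin 4 → ℕ → ℝ), ∑ i, (S i).card = n →
      (∀ i, ∀ j ∈ S i, 0 < r i j) →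
      (∀ i, ∀ j ∈ S i, ∀ k ∈ S i, j ≠ k → r i j + r i k ≤ |c i j - c i k|) →
      ∫⁻ x : Plane, ∏ i, ∑ j ∈ S i, bump (c i j) (r i j) (A i x) ≤
        stripVolume A (fun i => ENNReal.ofReal (∑ j ∈ S i, r i j)) := by
  induction n with
  | zero =>
    intro S c r hn _ _
    have : S 0 = ∅ := by
      have := (Finset.sum_eq_zero_iff.1 hn) 0 (Finset.mem_univ _)
      simpa using this
    have h0 : ∀ x : Plane, ∏ i, ∑ j ∈ S i, bump (c i j) (r i j) (A i x) = 0 := fun x =>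
      Finset.prod_eq_zero (Finset.mem_univ 0) (by simp [this])
    simp [h0]
  | succ n ih =>
    intro S c r hn hr hd
    by_cases hlarge : ∃ i, 2 ≤ (S i).card
    · set P : Finset (Σ _ : Fin 4, ℕ × ℕ) := Finset.univ.sigma fun i => (S i).offDiag with hP
      have hPn : P.Nonempty := by
        obtain ⟨i, hi⟩ := hlarge
        obtain ⟨j, hj, k, hk, hjk⟩ := Finset.one_lt_card.1 hi
        exact ⟨⟨i, (j, k)⟩, by simp [hP, hj, hk, hjk]⟩
      obtain ⟨⟨i, j, k⟩, hmem, hmax⟩ := Finset.exists_max_image P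
        (fun q => (r q.1 q.2.1 + r q.1 q.2.2) / |c q.1 q.2.1 - c q.1 q.2.2|) hPn
      simp only [hP, Finset.mem_sigma, Finset.mem_univ, true_and, Finset.mem_offDiag] at hmem hmax
      obtain ⟨hj, hk, hjk⟩ := hmem
      set t := (r i j + r i k) / |c i j - c i k| with ht
      have hpos : ∀ i, ∀ j ∈ S i, ∀ k ∈ S i, j ≠ k → 0 < |c i j - c i k| :=
        fun i j hj k hk hjk => (add_pos (hr i j hj) (hr i k hk)).trans_le (hd i j hj k hk hjk)
      have hp := hpos i j hj k hk hjk
      have ht0 : 0 < t := div_pos (add_pos (hr i j hj) (hr i k hk)) hp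
      have ht1 : t ≤ 1 := (div_le_one hp).2 (hd i j hj k hk hjk)
      refine (lintegral_prod_sum_bump_le_smul hA S c r ht0.le ht1).trans ?_
      have hd2 : ∀ i, ∀ j ∈ S i, ∀ k ∈ S i, j ≠ k →
          r i j + r i k ≤ |t * c i j - t * c i k| := by
        intro i' j' hj' k' hk' hjk'
        have := hmax ⟨i', j', k'⟩ ⟨hj', hk', hjk'⟩
        rw [div_le_iff₀ (hpos i' j' hj' k' hk' hjk')] at this
        rw [← mul_sub, abs_mul, abs_of_pos ht0]
        exact this
      have htouch : |t * c i j - t * c i k| = r i j + r i k := by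
        rw [← mul_sub, abs_mul, abs_of_pos ht0, ht, div_mul_cancel₀ _ hp.ne']
      obtain ⟨S', c', r', hS', hr', hd', hsum, hle⟩ : ∃ (S' : Finset ℕ) (c' r' : ℕ → ℝ),
          S'.card + 1 = (S i).card ∧ (∀ j ∈ S', 0 < r' j) ∧
          (∀ j ∈ S', ∀ k ∈ S', j ≠ k → r' j + r' k ≤ |c' j - c' k|) ∧
          ∑ j ∈ S', r' j = ∑ j ∈ S i, r i j ∧
          ∀ u, ∑ j ∈ S i, bump (t * c i j) (r i j) u ≤ ∑ j ∈ S', bump (c' j) (r' j) u := by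
        have hrj := hr i j hj
        have hrk := hr i k hk
        rcases le_total (t * c i j) (t * c i k) with h | h
        · rw [abs_of_nonpos (by linarith)] at htouch
          exact exists_merge (c := fun j => t * c i j) (hr i) (hd2 i) hj hk (by linarith)
            (by linarith)
        · rw [abs_of_nonneg (by linarith)] at htouch
          exact exists_merge (c := fun j => t * c i j) (hr i) (hd2 i) hk hj (by linarith)
            (by linarith)
      have hih := ih (Function.update S i S') (Function.update (fun i j => t * c i j) i c')
        (Function.update r i r') ?_ ?_ ?_
      · refine le_trans (lintegral_mono fun x => ?_) (hih.trans (stripVolume_mono A fun l => ?_))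
        · refine Finset.prod_le_prod' fun l _ => ?_
          rcases eq_or_ne l i with rfl | hl
          · simpa using hle (A l x)
          · simp [hl]
        · rcases eq_or_ne l i with rfl | hl
          · simp [hsum]
          · simp [hl]
      · rw [← Finset.add_sum_erase _ _ (Finset.mem_univ i)] at hn ⊢
        have : ∑ x ∈ Finset.univ.erase i, (Function.update S i S' x).card =
            ∑ x ∈ Finset.univ.erase i, (S x).card :=
          Finset.sum_congr rfl fun l hl => by rw [Function.update_of_ne (Finset.ne_of_mem_erase hl)]
        rw [this, Function.update_self]
        omega
      · intro l
        rcases eq_or_ne l i with rfl | hl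
        · simpa using hr'
        · simpa [hl] using hr l
      · intro l
        rcases eq_or_ne l i with rfl | hl
        · simpa using hd'
        · simpa [hl] using hd2 l
    · push Not at hlarge
      by_cases hempty : ∃ i, S i = ∅
      · obtain ⟨i, hi⟩ := hempty
        have h0 : ∀ x : Plane, ∏ i, ∑ j ∈ S i, bump (c i j) (r i j) (A i x) = 0 := fun x =>
          Finset.prod_eq_zero (Finset.mem_univ i) (by simp [hi])
        simp [h0]
      · push Not at hempty
        have hone : ∀ i, ∃ j, S i = {j} := fun i => by
          rw [← Finset.card_eq_one]
          have h1 := hlarge i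
          have h2 := Finset.card_pos.2 (hempty i)
          omega
        choose p hp using hone
        refine (lintegral_prod_sum_bump_le_smul hA S c r le_rfl zero_le_one).trans ?_
        rw [stripVolume_ofReal, ← lintegral_prod_bump]
        simp [hp]

theorem stripVolume_smul (A : Forms) (r : Fin 4 → ℝ≥0∞) {s : ℝ} (hs : 0 < s) :
    stripVolume A (fun i => ENNReal.ofReal s * r i) = ENNReal.ofReal (s ^ 2) * stripVolume A r := by
  have h := Measure.addHaar_preimage_smul (volume : Measure Plane) hs.ne'
    {x : Plane | ∀ i, ENNReal.ofReal |A i x| < ENNReal.ofReal s * r i}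
  have h2 : (fun x : Plane => s • x) ⁻¹' {x : Plane | ∀ i, ENNReal.ofReal |A i x| <
      ENNReal.ofReal s * r i} = {x : Plane | ∀ i, ENNReal.ofReal |A i x| < r i} := by
    ext x
    refine forall_congr' fun i => ?_
    rw [map_smul, smul_eq_mul, abs_mul, abs_of_pos hs, ENNReal.ofReal_mul hs.le]
    exact ENNReal.mul_lt_mul_iff_right (by simpa using hs) ENNReal.ofReal_ne_top
  rw [h2] at h
  simp only [Module.finrank_prod, Module.finrank_self] at h
  rw [stripVolume, stripVolume, h, ← mul_assoc, ← ENNReal.ofReal_mul (by positivity),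
    abs_of_pos (by positivity)]
  norm_num
  rw [mul_inv_cancel₀ (by positivity)]
  simp

theorem le_of_forall_le_ofReal_sq_mul {a b : ℝ≥0∞}
    (h : ∀ s : ℝ, 1 < s → a ≤ ENNReal.ofReal (s ^ 2) * b) : a ≤ b := by
  have h1 : Tendsto (fun s : ℝ => ENNReal.ofReal (s ^ 2)) (𝓝[>] 1) (𝓝 (ENNReal.ofReal (1 ^ 2))) :=
    (ENNReal.tendsto_ofReal ((continuous_pow 2).tendsto (1 : ℝ))).mono_left nhdsWithin_le_nhds
  have h2 := ENNReal.Tendsto.mul_const (b := b) h1 (Or.inl (by simp))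
  rw [one_pow, ENNReal.ofReal_one, one_mul] at h2
  exact ge_of_tendsto h2 (eventually_mem_nhdsWithin.mono fun s hs => h s hs)

/-- Two transversal forms give linear coordinates on the plane. -/
theorem exists_lintegral_comp_eq {f g : Plane →ₗ[ℝ] ℝ}
    (h : Function.Bijective (fun x : Plane => ((f x, g x) : Plane))) :
    ∃ C : ℝ≥0∞, C ≠ ∞ ∧ ∀ F : Plane → ℝ≥0∞, ∫⁻ x : Plane, F (f x, g x) = C * ∫⁻ x, F x := by
  let e : Plane ≃ₗ[ℝ] Plane := LinearEquiv.ofBijective (f.prod g) h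
  have hdet : LinearMap.det (e : Plane →ₗ[ℝ] Plane) ≠ 0 := e.isUnit_det'.ne_zero
  refine ⟨ENNReal.ofReal |(LinearMap.det (e : Plane →ₗ[ℝ] Plane))⁻¹|, ENNReal.ofReal_ne_top,
    fun F => ?_⟩
  have h1 := lintegral_map_equiv (μ := (volume : Measure Plane)) F
    e.toContinuousLinearEquiv.toHomeomorph.toMeasurableEquiv
  have h2 := Measure.map_linearMap_addHaar_eq_smul_addHaar (volume : Measure Plane) hdet
  have h3 : Measure.map (e.toContinuousLinearEquiv.toHomeomorph.toMeasurableEquiv) volume =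
    Measure.map (e : Plane →ₗ[ℝ] Plane) (volume : Measure Plane) := rfl
  rw [h3, h2, lintegral_smul_measure] at h1
  exact h1.symm

theorem exists_index_ne (i : Fin 4) : ∃ j, i ≠ j := by
  by_cases h : i = 0
  · exact ⟨1, by rw [h]; decide⟩
  · exact ⟨0, h⟩

theorem Transversal.quasiMeasurePreserving {A : Forms} (hA : Transversal A) (i : Fin 4) :
    Measure.QuasiMeasurePreserving (A i) volume volume := by
  obtain ⟨j, hij⟩ := exists_index_ne i
  obtain ⟨C, hC, h⟩ := exists_lintegral_comp_eq (hA i j hij)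
  refine ⟨measurable_form _, Measure.AbsolutelyContinuous.mk fun N hN h0 => ?_⟩
  rw [Measure.map_apply (measurable_form _) hN,
    ← lintegral_indicator_one (measurable_form (A i) hN)]
  have h1 := h ((N ×ˢ univ).indicator 1)
  rw [lintegral_indicator_one (hN.prod MeasurableSet.univ), Measure.volume_eq_prod,
    Measure.prod_prod, h0, zero_mul, mul_zero] at h1
  rw [← h1]
  refine lintegral_congr fun x => ?_
  by_cases hx : A i x ∈ N <;> simp [indicator, hx]

theorem measure_biUnion_cells_le {U : Set ℝ} {S : Finset ℕ} {c r : ℕ → ℝ}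
    (hd : ∀ j ∈ S, ∀ k ∈ S, j ≠ k → r j + r k ≤ |c j - c k|) (hr : ∀ j ∈ S, 0 < r j)
    (hU : ∀ j ∈ S, Ioo (c j - r j) (c j + r j) ⊆ U) :
    ENNReal.ofReal (∑ j ∈ S, r j) ≤ volume U / 2 := by
  rw [ENNReal.le_div_iff_mul_le (by simp) (by simp), show (2 : ℝ≥0∞) = ENNReal.ofReal 2 by simp,
    ← ENNReal.ofReal_mul (Finset.sum_nonneg fun j hj => (hr j hj).le), Finset.sum_mul,
    ENNReal.ofReal_sum_of_nonneg (fun j hj => by have := hr j hj; positivity)]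
  have : ∀ j, ENNReal.ofReal (r j * 2) = volume (Ioo (c j - r j) (c j + r j)) := fun j => by
    rw [Real.volume_Ioo]; congr 1; ring
  simp_rw [this]
  rw [← measure_biUnion_finset _ (fun j _ => measurableSet_Ioo)]
  · exact measure_mono (iUnion₂_subset hU)
  · intro j hj k hk hjk
    rw [Function.onFun, Set.disjoint_left]
    rintro x ⟨h1, h2⟩ ⟨h3, h4⟩
    have := hd j hj k hk hjk
    rcases le_total (c j) (c k) with h | h
    · rw [abs_of_nonpos (by linarith)] at this; linarith
    · rw [abs_of_nonneg (by linarith)] at this; linarith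

/-- Open sets are filled by disjoint grid cells. -/
theorem exists_grid (n : ℕ) (U : Set ℝ) : ∃ (S : Finset ℕ) (c r : ℕ → ℝ),
    (∀ j ∈ S, 0 < r j) ∧ (∀ j ∈ S, ∀ k ∈ S, j ≠ k → r j + r k ≤ |c j - c k|) ∧
    (∀ j ∈ S, Ioo (c j - r j) (c j + r j) ⊆ U) ∧
    ∀ u : ℝ, Irrational u → |u| < n + 1 → Metric.ball u (1 / (n + 1)) ⊆ U →
      1 ≤ ∑ j ∈ S, bump (c j) (r j) u := by
  classical
  set N : ℝ := n + 1 with hN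
  have hN0 : 0 < N := by positivity
  set c : ℕ → ℝ := fun j => (j + 1 / 2) / N - N with hc
  set r : ℝ := 1 / (2 * N) with hr
  have hr0 : 0 < r := by positivity
  have h1 : ∀ j : ℕ, c j - r = j / N - N := fun j => by
    simp only [hc, hr]; field_simp; ring
  have h2 : ∀ j : ℕ, c j + r = (j + 1) / N - N := fun j => by
    simp only [hc, hr]; field_simp; ring
  refine ⟨(Finset.range (2 * (n + 1) ^ 2)).filter fun j => Ioo (c j - r) (c j + r) ⊆ U, c,
    fun _ => r, fun _ _ => hr0, ?_, fun j hj => (Finset.mem_filter.1 hj).2, ?_⟩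
  · intro j _ k _ hjk
    have h3 : c j - c k = ((j : ℝ) - k) / N := by simp only [hc]; ring
    have h4 : (1 : ℝ) ≤ |(j : ℝ) - k| := by
      have : (1 : ℤ) ≤ |(j : ℤ) - k| := Int.one_le_abs (sub_ne_zero.2 (by exact_mod_cast hjk))
      exact_mod_cast this
    rw [h3, abs_div, abs_of_pos hN0, hr, le_div_iff₀ hN0]
    field_simp
    linarith
  · intro u hu huN hball
    have hpos : 0 ≤ (u + N) * N := by
      have := (abs_lt.1 huN).1
      exact mul_nonneg (by linarith) hN0.le
    set j := ⌊(u + N) * N⌋₊ with hj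
    have hj1 : (j : ℝ) ≤ (u + N) * N := Nat.floor_le hpos
    have hj2 : (u + N) * N < j + 1 := Nat.lt_floor_add_one _
    have hne : (j : ℝ) ≠ (u + N) * N := by
      intro h
      have : u = ((j / (n + 1) - (n + 1) : ℚ) : ℝ) := by
        push_cast
        rw [← hN]
        field_simp
        linarith
      exact (irrational_iff_ne_rational u).1 hu _ _ (by
        exact_mod_cast (Rat.den_nz _)) (this.trans (Rat.cast_def _))
    have hu1 : c j - r < u := by
      rw [h1, sub_lt_iff_lt_add, div_lt_iff₀ hN0]
      exact lt_of_le_of_ne hj1 hne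
    have hu2 : u < c j + r := by
      rw [h2, lt_sub_iff_add_lt, lt_div_iff₀ hN0]
      exact hj2
    have hmem : j ∈ (Finset.range (2 * (n + 1) ^ 2)).filter
        fun j => Ioo (c j - r) (c j + r) ⊆ U := by
      rw [Finset.mem_filter, Finset.mem_range]
      constructor
      · have : (j : ℝ) < ((2 * (n + 1) ^ 2 : ℕ) : ℝ) := by
          push_cast
          have := (abs_lt.1 huN).2
          rw [← hN]
          nlinarith
        exact_mod_cast this
      · refine Subset.trans ?_ hball
        intro v hv
        rw [Metric.mem_ball, Real.dist_eq, abs_lt]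
        have : 1 / N = 2 * r := by rw [hr]; field_simp
        rw [this]
        constructor <;> linarith [hv.1, hv.2]
    refine le_trans ?_ (Finset.single_le_sum (f := fun j => bump (c j) r u)
      (fun _ _ => zero_le) hmem)
    have : |u - c j| < r := by rw [abs_lt]; constructor <;> linarith
    simp [bump, this]

theorem volume_forall_mem_open_le {A : Forms} (hA : Transversal A) {U : Fin 4 → Set ℝ}
    (hU : ∀ i, IsOpen (U i)) :
    volume {x : Plane | ∀ i, A i x ∈ U i} ≤ stripVolume A (fun i => volume (U i) / 2) := by
  choose S c r hr hd hsub hone using fun (n : ℕ) (i : Fin 4) => exists_grid n (U i)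
  set F : ℕ → Plane → ℝ≥0∞ := fun n x => ∏ i, ∑ j ∈ S n i, bump (c n i j) (r n i j) (A i x)
    with hF
  have hFm : ∀ n, Measurable (F n) := fun n => Finset.measurable_prod _ fun i _ =>
    Finset.measurable_sum _ fun j _ => (measurable_bump _ _).comp (measurable_form (A i))
  have hFle : ∀ n, ∫⁻ x, F n x ≤ stripVolume A (fun i => volume (U i) / 2) := fun n =>
    (lintegral_prod_sum_bump_le hA _ (S n) (c n) (r n) rfl (hr n) (hd n)).trans
      (stripVolume_mono A fun i => measure_biUnion_cells_le (hd n i) (hr n i) (hsub n i))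
  have hirr : ∀ᵐ x : Plane, ∀ i, Irrational (A i x) := by
    rw [ae_all_iff]
    intro i
    refine (hA.quasiMeasurePreserving i).ae ?_
    have := (Set.countable_range ((↑) : ℚ → ℝ)).ae_notMem volume
    exact this
  have hmeas : MeasurableSet {x : Plane | ∀ i, A i x ∈ U i} := by
    have : {x : Plane | ∀ i, A i x ∈ U i} = ⋂ i, (A i) ⁻¹' (U i) := by ext; simp
    rw [this]
    exact MeasurableSet.iInter fun i => measurable_form _ (hU i).measurableSet
  rw [← lintegral_indicator_one hmeas]
  calc ∫⁻ x, {x : Plane | ∀ i, A i x ∈ U i}.indicator 1 x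
      ≤ ∫⁻ x, liminf (fun n => F n x) atTop := by
        refine lintegral_mono_ae (hirr.mono fun x hx => ?_)
        by_cases hxU : ∀ i, A i x ∈ U i
        · rw [indicator_of_mem (show x ∈ {x : Plane | ∀ i, A i x ∈ U i} from hxU)]
          refine le_liminf_of_le (by isBoundedDefault) ?_
          have hev : ∀ i, ∀ᶠ n : ℕ in atTop, 1 ≤ ∑ j ∈ S n i, bump (c n i j) (r n i j) (A i x) := by
            intro i
            obtain ⟨ε, hε, hball⟩ := Metric.isOpen_iff.1 (hU i) _ (hxU i)
            filter_upwards [(tendsto_one_div_add_atTop_nhds_zero_nat (𝕜 := ℝ)).eventually_lt_const hε,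
              eventually_ge_atTop ⌈|A i x|⌉₊] with n hn1 hn2
            refine hone n i _ (hx i) ?_ ((Metric.ball_subset_ball hn1.le).trans hball)
            have := Nat.ceil_le.1 hn2
            linarith
          filter_upwards [eventually_all.2 hev] with n hn
          exact Finset.one_le_prod' fun i _ => hn i
        · rw [indicator_of_notMem (show x ∉ {x : Plane | ∀ i, A i x ∈ U i} from hxU)]
          exact zero_le
    _ ≤ liminf (fun n => ∫⁻ x, F n x) atTop := lintegral_liminf_le hFm
    _ ≤ _ := liminf_le_of_frequently_le' (Frequently.of_forall hFle)

/-- The Brascamp–Lieb–Luttinger rearrangement inequality for four linear forms on the plane. -/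
theorem volume_forall_mem_le {A : Forms} (hA : Transversal A) (E : Fin 4 → Set ℝ) :
    volume {x : Plane | ∀ i, A i x ∈ E i} ≤ stripVolume A (fun i => volume (E i) / 2) := by
  by_cases h0 : ∃ i, volume (E i) = 0
  · obtain ⟨i, hi⟩ := h0
    have : volume ((A i) ⁻¹' (E i)) = 0 := (hA.quasiMeasurePreserving i).preimage_null hi
    have hnull : volume {x : Plane | ∀ i, A i x ∈ E i} = 0 :=
      measure_mono_null (fun x (hx : ∀ i, A i x ∈ E i) => hx i) this
    exact hnull.trans_le zero_le
  push Not at h0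
  refine le_of_forall_le_ofReal_sq_mul fun s hs => ?_
  rw [← stripVolume_smul A _ (by linarith)]
  have : ∀ i, ∃ U, E i ⊆ U ∧ IsOpen U ∧ volume U ≤ ENNReal.ofReal s * volume (E i) := by
    intro i
    rcases eq_or_ne (volume (E i)) ∞ with h | h
    · refine ⟨univ, subset_univ _, isOpen_univ, ?_⟩
      rw [h, ENNReal.mul_top (by simp; linarith)]
      exact le_top
    · obtain ⟨U, hEU, hU, hlt⟩ := (E i).exists_isOpen_lt_of_lt (μ := volume)
        (ENNReal.ofReal s * volume (E i)) (by
          conv_lhs => rw [← one_mul (volume (E i))]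
          refine (ENNReal.mul_lt_mul_iff_left (h0 i) h).2 ?_
          rw [← ENNReal.ofReal_one]
          exact (ENNReal.ofReal_lt_ofReal_iff (by linarith)).2 hs)
      exact ⟨U, hEU, hU, hlt.le⟩
  choose U hEU hU hle using this
  refine (measure_mono fun x (hx : ∀ i, A i x ∈ E i) i => hEU i (hx i)).trans
    ((volume_forall_mem_open_le hA hU).trans (stripVolume_mono A fun i => ?_))
  rw [← mul_div_assoc]
  exact ENNReal.div_le_div_right (hle i) 2

theorem volume_ofReal_abs_lt (r : ℝ≥0∞) : volume {v : ℝ | ENNReal.ofReal |v| < r} = 2 * r := by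
  rcases eq_or_ne r ∞ with rfl | hr
  · simp
  · have : {v : ℝ | ENNReal.ofReal |v| < r} = Ioo (-r.toReal) r.toReal := by
      ext v
      rw [mem_Ioo, ← abs_lt, ← ENNReal.ofReal_lt_iff_lt_toReal (abs_nonneg v) hr, mem_ofPred_eq]
    rw [this, Real.volume_Ioo, sub_neg_eq_add, ENNReal.ofReal_add (by simp) (by simp),
      ENNReal.ofReal_toReal hr, two_mul]

/-- The area of the region `|v| < g |u|`. -/
noncomputable def mass (g : ℝ → ℝ≥0∞) : ℝ≥0∞ := ∫⁻ u : ℝ, 2 * g |u|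

/-- The planar region `|v| < g |u|`. -/
def body (g : ℝ → ℝ≥0∞) : Set Plane := {z | ENNReal.ofReal |z.2| < g |z.1|}

theorem measurableSet_body {g : ℝ → ℝ≥0∞} (hg : Measurable g) : MeasurableSet (body g) :=
  measurableSet_lt (by fun_prop) (by fun_prop)

theorem volume_body {g : ℝ → ℝ≥0∞} (hg : Measurable g) : volume (body g) = mass g := by
  rw [volume_plane_eq (measurableSet_body hg), mass]
  refine lintegral_congr fun p => ?_
  exact volume_ofReal_abs_lt (g |p|)

/-- The measure of the points of `ℝ⁴` all of whose images lie in the sets `E i`. -/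
noncomputable def incidence (A B : Forms) (E : Fin 4 → Set Plane) : ℝ≥0∞ :=
  volume {z : Space4 | ∀ i, (A i z.1, B i z.2) ∈ E i}

theorem measurableSet_incidence (A B : Forms) {E : Fin 4 → Set Plane}
    (hE : ∀ i, MeasurableSet (E i)) :
    MeasurableSet {z : Space4 | ∀ i, (A i z.1, B i z.2) ∈ E i} := by
  have : {z : Space4 | ∀ i, (A i z.1, B i z.2) ∈ E i} =
      ⋂ i, (fun z : Space4 => ((A i z.1, B i z.2) : Plane)) ⁻¹' (E i) := by ext; simp
  rw [this]
  refine MeasurableSet.iInter fun i => ?_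
  exact (((measurable_form (A i)).comp measurable_fst).prodMk
    ((measurable_form (B i)).comp measurable_snd)) (hE i)

/-- The form evaluated on the regions `|v| < g i |u|`. -/
noncomputable def profileForm (A B : Forms) (g : Fin 4 → ℝ → ℝ≥0∞) : ℝ≥0∞ :=
  ∫⁻ x : Plane, stripVolume B (fun i => g i |A i x|)

theorem measurable_stripVolume (A B : Forms) {g : Fin 4 → ℝ → ℝ≥0∞} (hg : ∀ i, Measurable (g i)) :
    Measurable fun x : Plane => stripVolume B (fun i => g i |A i x|) :=
  measurable_measure_prodMk_left
    (measurableSet_incidence A B fun i => measurableSet_body (hg i))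

theorem incidence_body (A B : Forms) {g : Fin 4 → ℝ → ℝ≥0∞} (hg : ∀ i, Measurable (g i)) :
    incidence A B (fun i => body (g i)) = profileForm A B g := by
  rw [incidence, Measure.volume_eq_prod,
    Measure.prod_apply (measurableSet_incidence A B fun i => measurableSet_body (hg i))]
  rfl

/-- Symmetrization: every tuple of sets is dominated by one given by decreasing profiles. -/
theorem exists_antitone_profile {A B : Forms} (hA : Transversal A) (hB : Transversal B)
    {E : Fin 4 → Set Plane} (hE : ∀ i, MeasurableSet (E i)) :
    ∃ g : Fin 4 → ℝ → ℝ≥0∞, (∀ i, Antitone (g i)) ∧ (∀ i, mass (g i) = volume (E i)) ∧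
      incidence A B E ≤ profileForm A B g := by
  set f : Fin 4 → ℝ → ℝ≥0∞ := fun i v => volume {u : ℝ | (u, v) ∈ E i} / 2 with hf
  have hfm : ∀ i, Measurable (f i) := fun i =>
    (measurable_measure_prodMk_right (μ := (volume : Measure ℝ)) (hE i)).div_const 2
  set g : Fin 4 → ℝ → ℝ≥0∞ := fun i s => volume {v : ℝ | ENNReal.ofReal s < f i v} / 2 with hg
  have hsw : ∀ i, MeasurableSet {z : Plane | ENNReal.ofReal |z.1| < f i z.2} := fun i =>
    measurableSet_lt (by fun_prop) ((hfm i).comp measurable_snd)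
  refine ⟨g, fun i s t hst => ?_, fun i => ?_, ?_⟩
  · refine ENNReal.div_le_div_right (measure_mono fun v hv => ?_) 2
    exact (ENNReal.ofReal_le_ofReal hst).trans_lt hv
  · have h2 : ∀ a : ℝ≥0∞, 2 * (a / 2) = a := fun a =>
      ENNReal.mul_div_cancel (by simp) (by simp)
    calc mass (g i) = ∫⁻ u : ℝ, volume {v : ℝ | ENNReal.ofReal |u| < f i v} := by
          simp only [mass, hg, h2]
      _ = volume {z : Plane | ENNReal.ofReal |z.1| < f i z.2} :=
          (Measure.prod_apply (hsw i)).symm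
      _ = ∫⁻ v : ℝ, volume {u : ℝ | ENNReal.ofReal |u| < f i v} :=
          Measure.prod_apply_symm (hsw i)
      _ = ∫⁻ v : ℝ, volume {u : ℝ | (u, v) ∈ E i} := by
          simp only [volume_ofReal_abs_lt, hf, h2]
      _ = volume (E i) := (Measure.prod_apply_symm (hE i)).symm
  · have hm := measurableSet_incidence A B hsw
    calc incidence A B E
        = ∫⁻ y : Plane, volume {x : Plane | ∀ i, (A i x, B i y) ∈ E i} :=
          Measure.prod_apply_symm (measurableSet_incidence A B hE)
      _ ≤ ∫⁻ y : Plane, stripVolume A (fun i => f i (B i y)) :=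
          lintegral_mono fun y => volume_forall_mem_le hA fun i => {u : ℝ | (u, B i y) ∈ E i}
      _ = volume {z : Space4 | ∀ i, ((A i z.1, B i z.2) : Plane) ∈
            {z : Plane | ENNReal.ofReal |z.1| < f i z.2}} := (Measure.prod_apply_symm hm).symm
      _ = ∫⁻ x : Plane, volume {y : Plane | ∀ i, B i y ∈
            {v : ℝ | ENNReal.ofReal |A i x| < f i v}} := Measure.prod_apply hm
      _ ≤ profileForm A B g :=
          lintegral_mono fun x => volume_forall_mem_le hB fun i =>
            {v : ℝ | ENNReal.ofReal |A i x| < f i v}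

/-- The supremum of `profileForm` over profiles with masses at most `m`. -/
noncomputable def supForm (A B : Forms) (m : Fin 4 → ℝ≥0∞) : ℝ≥0∞ :=
  ⨆ (g : Fin 4 → ℝ → ℝ≥0∞) (_ : (∀ i, Measurable (g i)) ∧ ∀ i, mass (g i) ≤ m i),
    profileForm A B g

theorem profileForm_le_supForm (A B : Forms) {g : Fin 4 → ℝ → ℝ≥0∞} (hg : ∀ i, Measurable (g i))
    {m : Fin 4 → ℝ≥0∞} (hm : ∀ i, mass (g i) ≤ m i) : profileForm A B g ≤ supForm A B m :=
  le_iSup₂_of_le g ⟨hg, hm⟩ le_rfl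

theorem supForm_mono (A B : Forms) {m m' : Fin 4 → ℝ≥0∞} (h : ∀ i, m i ≤ m' i) :
    supForm A B m ≤ supForm A B m' :=
  iSup₂_le fun _ hg => profileForm_le_supForm A B hg.1 fun i => (hg.2 i).trans (h i)

theorem incidence_le_supForm {A B : Forms} (hA : Transversal A) (hB : Transversal B)
    {E : Fin 4 → Set Plane} (hE : ∀ i, MeasurableSet (E i)) :
    incidence A B E ≤ supForm A B (fun i => volume (E i)) := by
  obtain ⟨g, hg, hm, hle⟩ := exists_antitone_profile hA hB hE
  exact hle.trans (profileForm_le_supForm A B (fun i => (hg i).measurable) fun i => (hm i).le)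

theorem exists_antitone_profileForm_le {A B : Forms} (hA : Transversal A) (hB : Transversal B)
    {g : Fin 4 → ℝ → ℝ≥0∞} (hg : ∀ i, Measurable (g i)) :
    ∃ g' : Fin 4 → ℝ → ℝ≥0∞, (∀ i, Antitone (g' i)) ∧ (∀ i, mass (g' i) = mass (g i)) ∧
      profileForm A B g ≤ profileForm A B g' := by
  obtain ⟨g', h1, h2, h3⟩ := exists_antitone_profile hA hB (E := fun i => body (g i))
    fun i => measurableSet_body (hg i)
  refine ⟨g', h1, fun i => ?_, ?_⟩
  · rw [h2, volume_body (hg i)]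
  · rwa [incidence_body A B hg] at h3

theorem stripVolume_eq_zero (B : Forms) {r : Fin 4 → ℝ≥0∞} {i : Fin 4} (h : r i = 0) :
    stripVolume B r = 0 := by
  have : {x : Plane | ∀ i, ENNReal.ofReal |B i x| < r i} = ∅ := by
    rw [eq_empty_iff_forall_notMem]
    intro x hx
    have := hx i
    rw [h] at this
    exact not_lt_zero this
  rw [stripVolume, this, measure_empty]

theorem stripVolume_add_lt {B : Forms} (hB : Transversal B) {r s : Fin 4 → ℝ≥0∞}
    (hr : ∀ i, r i ≠ 0) (hs : ∀ i, s i ≠ 0) (hr' : ∀ i, r i ≠ ∞) (hs' : ∀ i, s i ≠ ∞) :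
    stripVolume B r + stripVolume B s < stripVolume B (fun i => r i + s i) := by
  have h := volume_strips_add_lt hB (r := fun i => (r i).toReal) (s := fun i => (s i).toReal)
    (fun i => ENNReal.toReal_pos (hr i) (hr' i)) (fun i => ENNReal.toReal_pos (hs i) (hs' i))
  rw [← stripVolume_ofReal, ← stripVolume_ofReal, ← stripVolume_ofReal] at h
  simpa only [Pi.add_apply, ENNReal.ofReal_add ENNReal.toReal_nonneg ENNReal.toReal_nonneg,
    ENNReal.ofReal_toReal (hr' _), ENNReal.ofReal_toReal (hs' _)] using h

theorem stripVolume_add_le {B : Forms} (hB : Transversal B) {r s : Fin 4 → ℝ≥0∞}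
    (hr' : ∀ i, r i ≠ ∞) (hs' : ∀ i, s i ≠ ∞) :
    stripVolume B r + stripVolume B s ≤ stripVolume B (fun i => r i + s i) := by
  by_cases hr : ∃ i, r i = 0
  · obtain ⟨i, hi⟩ := hr
    rw [stripVolume_eq_zero B hi, zero_add]
    exact stripVolume_mono B fun i => le_add_self
  by_cases hs : ∃ i, s i = 0
  · obtain ⟨i, hi⟩ := hs
    rw [stripVolume_eq_zero B hi, add_zero]
    exact stripVolume_mono B fun i => le_self_add
  push Not at hr hs
  exact (stripVolume_add_lt hB hr hs hr' hs').le

theorem mass_add {g h : ℝ → ℝ≥0∞} (hg : Measurable g) : mass (fun t => g t + h t) =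
    mass g + mass h := by
  simp only [mass, mul_add]
  exact lintegral_add_left (by fun_prop) _

theorem mass_const_mul {g : ℝ → ℝ≥0∞} (hg : Measurable g) (c : ℝ≥0∞) :
    mass (fun t => c * g t) = c * mass g := by
  simp only [mass]
  rw [← lintegral_const_mul c (by fun_prop)]
  refine lintegral_congr fun u => ?_
  ring

theorem ae_ne_top_of_mass {A : Forms} (hA : Transversal A) {g : Fin 4 → ℝ → ℝ≥0∞}
    (hg : ∀ i, Measurable (g i)) (hm : ∀ i, mass (g i) ≠ ∞) :
    ∀ᵐ x : Plane, ∀ i, g i |A i x| ≠ ∞ := by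
  rw [ae_all_iff]
  intro i
  refine (hA.quasiMeasurePreserving i).ae (p := fun u => g i |u| ≠ ∞) ?_
  filter_upwards [ae_lt_top (by have := hg i; fun_prop) (hm i)] with u hu
  rintro h
  simp [h] at hu

theorem profileForm_add_le {A B : Forms} (hA : Transversal A) (hB : Transversal B)
    {g h : Fin 4 → ℝ → ℝ≥0∞} (hg : ∀ i, Measurable (g i)) (hh : ∀ i, Measurable (h i))
    (hgm : ∀ i, mass (g i) ≠ ∞) (hhm : ∀ i, mass (h i) ≠ ∞) :
    profileForm A B g + profileForm A B h ≤ profileForm A B (fun i t => g i t + h i t) := by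
  rw [profileForm, profileForm, ← lintegral_add_left (measurable_stripVolume A B hg)]
  refine lintegral_mono_ae ?_
  filter_upwards [ae_ne_top_of_mass hA hg hgm, ae_ne_top_of_mass hA hh hhm] with x h1 h2
  exact stripVolume_add_le hB h1 h2

theorem supForm_add_le {A B : Forms} (hA : Transversal A) (hB : Transversal B)
    {m m' : Fin 4 → ℝ≥0∞} (hm : ∀ i, m i ≠ ∞) (hm' : ∀ i, m' i ≠ ∞) :
    supForm A B m + supForm A B m' ≤ supForm A B (fun i => m i + m' i) := by
  have h0 : (∀ i, Measurable ((fun _ _ => 0 : Fin 4 → ℝ → ℝ≥0∞) i)) := fun _ => measurable_const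
  refine ENNReal.biSup_add_biSup_le' ⟨fun _ _ => 0, h0, fun i => by simp [mass]⟩
    ⟨fun _ _ => 0, h0, fun i => by simp [mass]⟩ ?_
  rintro g ⟨hg, hgm⟩ h ⟨hh, hhm⟩
  refine (profileForm_add_le hA hB hg hh (fun i => ((hgm i).trans_lt (hm i).lt_top).ne)
    (fun i => ((hhm i).trans_lt (hm' i).lt_top).ne)).trans
    (profileForm_le_supForm A B (fun i => (hg i).add (hh i)) fun i => ?_)
  exact (mass_add (hg i)).trans_le (add_le_add (hgm i) (hhm i))

theorem exists_stripVolume_le {B : Forms} (hB : Transversal B) : ∃ C : ℝ≥0∞, C ≠ ∞ ∧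
    ∀ i j, i ≠ j → ∀ r : Fin 4 → ℝ≥0∞, stripVolume B r ≤ C * (r i * r j) := by
  have : ∀ i j, ∃ C : ℝ≥0∞, C ≠ ∞ ∧ (i ≠ j → ∀ r : Fin 4 → ℝ≥0∞,
      stripVolume B r ≤ C * (r i * r j)) := by
    intro i j
    by_cases hij : i = j
    · exact ⟨0, by simp, fun h => absurd hij h⟩
    obtain ⟨C, hC, h⟩ := exists_lintegral_comp_eq (hB i j hij)
    refine ⟨C * 4, ENNReal.mul_ne_top hC (by simp), fun _ r => ?_⟩
    set I : ℝ≥0∞ → Set ℝ := fun r => {v : ℝ | ENNReal.ofReal |v| < r} with hI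
    have hIm : ∀ r, MeasurableSet (I r) := fun r => measurableSet_lt (by fun_prop) measurable_const
    have h1 := h ((I (r i) ×ˢ I (r j)).indicator 1)
    rw [lintegral_indicator_one ((hIm _).prod (hIm _)), Measure.volume_eq_prod, Measure.prod_prod,
      volume_ofReal_abs_lt, volume_ofReal_abs_lt] at h1
    have hm : MeasurableSet ((fun x : Plane => ((B i x, B j x) : Plane)) ⁻¹'
        (I (r i) ×ˢ I (r j))) :=
      ((measurable_form (B i)).prodMk (measurable_form (B j))) ((hIm _).prod (hIm _))
    calc stripVolume B r ≤ volume ((fun x : Plane => ((B i x, B j x) : Plane)) ⁻¹'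
          (I (r i) ×ˢ I (r j))) := measure_mono fun x hx => ⟨hx i, hx j⟩
      _ = C * (2 * r i * (2 * r j)) := by
          rw [← h1, ← lintegral_indicator_one hm]
          rfl
      _ = C * 4 * (r i * r j) := by ring
  choose C hC h using this
  refine ⟨∑ i, ∑ j, C i j, ?_, fun i j hij r => (h i j hij r).trans ?_⟩
  · simp [hC]
  · gcongr
    exact (Finset.single_le_sum (f := fun j => C i j) (fun _ _ => zero_le)
      (Finset.mem_univ j)).trans (Finset.single_le_sum (f := fun i => ∑ j, C i j)
      (fun _ _ => zero_le) (Finset.mem_univ i))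

theorem supForm_ne_top {A B : Forms} (hA : Transversal A) (hB : Transversal B)
    {m : Fin 4 → ℝ≥0∞} (hm : ∀ i, m i ≠ ∞) : supForm A B m ≠ ∞ := by
  obtain ⟨C, hC, h⟩ := exists_stripVolume_le hB
  obtain ⟨D, hD, h'⟩ := exists_lintegral_comp_eq (hA 0 1 (by decide))
  refine ((?_ : supForm A B m ≤ C * (D * (m 0 * m 1))).trans_lt ?_).ne
  · refine iSup₂_le fun g hg => ?_
    have hg0 := hg.1 0
    have hg1 := hg.1 1
    calc profileForm A B g ≤ ∫⁻ x : Plane, C * ((2 * g 0 |A 0 x|) * (2 * g 1 |A 1 x|)) := by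
          refine lintegral_mono fun x => (h 0 1 (by decide) _).trans ?_
          gcongr
          · exact le_mul_of_one_le_left zero_le (by norm_num)
          · exact le_mul_of_one_le_left zero_le (by norm_num)
      _ = C * ∫⁻ x : Plane, ((2 * g 0 |A 0 x|) * (2 * g 1 |A 1 x|)) :=
          lintegral_const_mul' _ _ hC
      _ = C * (D * ∫⁻ x : Plane, (2 * g 0 |x.1|) * (2 * g 1 |x.2|)) := by
          rw [← h' fun x => (2 * g 0 |x.1|) * (2 * g 1 |x.2|)]
      _ = C * (D * (mass (g 0) * mass (g 1))) := by
          rw [Measure.volume_eq_prod, lintegral_prod_mul (f := fun u => 2 * g 0 |u|)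
            (g := fun u => 2 * g 1 |u|) (by fun_prop) (by fun_prop)]
          rfl
      _ ≤ _ := by gcongr <;> apply hg.2
  · exact ENNReal.mul_lt_top hC.lt_top (ENNReal.mul_lt_top hD.lt_top
      (ENNReal.mul_lt_top (hm 0).lt_top (hm 1).lt_top))

theorem mass_ne_zero_of_profileForm_ne_zero {A B : Forms} (hA : Transversal A)
    {g : Fin 4 → ℝ → ℝ≥0∞} (hg : ∀ i, Measurable (g i)) (h : profileForm A B g ≠ 0) (i : Fin 4) :
    mass (g i) ≠ 0 := by
  intro h0
  apply h
  have hgi := hg i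
  rw [mass, lintegral_eq_zero_iff (by fun_prop)] at h0
  rw [profileForm, lintegral_eq_zero_iff (measurable_stripVolume A B hg)]
  filter_upwards [(hA.quasiMeasurePreserving i).ae h0] with x hx
  refine stripVolume_eq_zero B (i := i) ?_
  simpa using hx

theorem exists_pos_ne_zero_of_mass {g : ℝ → ℝ≥0∞} (h : mass g ≠ 0) : ∃ t > 0, g t ≠ 0 := by
  by_contra! hc
  apply h
  rw [mass]
  have : ∀ᵐ u : ℝ, 2 * g |u| = 0 := by
    filter_upwards [(Set.countable_singleton (0 : ℝ)).ae_notMem volume] with u hu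
    rw [hc |u| (abs_pos.2 hu), mul_zero]
  rw [lintegral_congr_ae this, lintegral_zero]

theorem exists_common_pos {g : Fin 4 → ℝ → ℝ≥0∞} (hg : ∀ i, Antitone (g i))
    (h : ∀ i, mass (g i) ≠ 0) : ∃ t > 0, ∀ i, ∀ s ≤ t, g i s ≠ 0 := by
  choose t ht hgt using fun i => exists_pos_ne_zero_of_mass (h i)
  refine ⟨Finset.univ.inf' Finset.univ_nonempty t, (Finset.lt_inf'_iff _).2 fun i _ => ht i,
    fun i s hs h0 => hgt i ?_⟩
  have : s ≤ t i := hs.trans (Finset.inf'_le _ (Finset.mem_univ i))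
  exact le_antisymm ((hg i this).trans h0.le) zero_le

/-- Superposing two nontrivial decreasing profiles is strictly better than keeping them apart. -/
theorem profileForm_add_lt {A B : Forms} (hA : Transversal A) (hB : Transversal B)
    {g h : Fin 4 → ℝ → ℝ≥0∞} (hg : ∀ i, Antitone (g i)) (hh : ∀ i, Antitone (h i))
    (hgm : ∀ i, mass (g i) ≠ ∞) (hhm : ∀ i, mass (h i) ≠ ∞)
    (hg0 : profileForm A B g ≠ 0) (hh0 : profileForm A B h ≠ 0) :
    profileForm A B g + profileForm A B h < profileForm A B (fun i t => g i t + h i t) := by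
  have hgM := fun i => (hg i).measurable
  have hhM := fun i => (hh i).measurable
  obtain ⟨s, hs, hgs⟩ := exists_common_pos hg fun i =>
    mass_ne_zero_of_profileForm_ne_zero hA hgM hg0 i
  obtain ⟨t, ht, hht⟩ := exists_common_pos hh fun i =>
    mass_ne_zero_of_profileForm_ne_zero hA hhM hh0 i
  have hfin : ∀ {g : Fin 4 → ℝ → ℝ≥0∞}, (∀ i, Antitone (g i)) → (∀ i, mass (g i) ≠ ∞) →
      profileForm A B g ≠ ∞ := fun {g} hg hgm =>
    ((profileForm_le_supForm A B (fun i => (hg i).measurable) fun _ => le_rfl).trans_lt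
      (supForm_ne_top hA hB hgm).lt_top).ne
  have hsum : profileForm A B g + profileForm A B h ≠ ∞ :=
    ENNReal.add_ne_top.2 ⟨hfin hg hgm, hfin hh hhm⟩
  rw [profileForm, profileForm, ← lintegral_add_left (measurable_stripVolume A B hgM)] at hsum ⊢
  have hae := (ae_ne_top_of_mass hA hgM hgm).and (ae_ne_top_of_mass hA hhM hhm)
  have hpos := volume_strips_zero_pos A (r := fun _ => min s t) fun _ => lt_min hs ht
  refine lintegral_strict_mono_of_ae_le_of_ae_lt_on (s := strips A 0 fun _ => min s t)
    (measurable_stripVolume A B fun i => (hgM i).add (hhM i)).aemeasurable hsum ?_ hpos.ne' ?_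
  · filter_upwards [hae] with x hx
    exact stripVolume_add_le hB hx.1 hx.2
  · filter_upwards [hae] with x hx hxW
    have hlt : ∀ i, |A i x| < min s t := fun i => by simpa using hxW i
    exact stripVolume_add_lt hB (fun i => hgs i _ ((hlt i).le.trans (min_le_left _ _)))
      (fun i => hht i _ ((hlt i).le.trans (min_le_right _ _))) hx.1 hx.2

/-- The largest absolute value of the forms at a point. -/
noncomputable def formSize (A : Forms) (x : Plane) : ℝ := ‖LinearMap.pi A x‖

theorem abs_le_formSize (A : Forms) (x : Plane) (i : Fin 4) : |A i x| ≤ formSize A x :=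
  norm_le_pi_norm (LinearMap.pi A x) i

theorem formSize_lt_iff (A : Forms) (x : Plane) {s : ℝ} (hs : 0 < s) :
    formSize A x < s ↔ ∀ i, |A i x| < s :=
  pi_norm_lt_iff hs

theorem measurable_formSize (A : Forms) : Measurable (formSize A) :=
  ((LinearMap.pi A).continuous_of_finiteDimensional.norm).measurable

theorem formSize_smul (A : Forms) {s : ℝ} (hs : 0 < s) (x : Plane) :
    formSize A (s • x) = s * formSize A x := by
  rw [formSize, map_smul, norm_smul, Real.norm_of_nonneg hs.le, formSize]

theorem Transversal.exists_mul_formSize_le {A : Forms} (hA : Transversal A) : ∃ c > 0,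
    ∀ x i j, i ≠ j → c * formSize A x ≤ max |A i x| |A j x| := by
  set T : Plane →L[ℝ] (Fin 4 → ℝ) := LinearMap.toContinuousLinearMap (LinearMap.pi A) with hT
  have : ∀ i j, ∃ C > 0, i ≠ j → ∀ x : Plane, ‖x‖ ≤ C * max |A i x| |A j x| := by
    intro i j
    by_cases hij : i = j
    · exact ⟨1, one_pos, fun h => absurd hij h⟩
    · obtain ⟨C, hC, h⟩ := exists_norm_le_of_bijective (hA i j hij)
      exact ⟨C, hC, fun _ => h⟩
  choose C hC h using this
  set D := ∑ i, ∑ j, C i j with hD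
  have hCD : ∀ i j, C i j ≤ D := fun i j =>
    (Finset.single_le_sum (f := fun j => C i j) (fun _ _ => (hC _ _).le)
      (Finset.mem_univ j)).trans (Finset.single_le_sum (f := fun i => ∑ j, C i j)
      (fun _ _ => Finset.sum_nonneg fun _ _ => (hC _ _).le) (Finset.mem_univ i))
  have hD0 : 0 < D := (hC 0 0).trans_le (hCD 0 0)
  refine ⟨((‖T‖ + 1) * D)⁻¹, by positivity, fun x i j hij => ?_⟩
  rw [inv_mul_le_iff₀ (by positivity)]
  calc formSize A x = ‖T x‖ := rfl
    _ ≤ ‖T‖ * ‖x‖ := T.le_opNorm x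
    _ ≤ (‖T‖ + 1) * (D * max |A i x| |A j x|) := by
        gcongr
        · linarith
        · exact (h i j hij x).trans (by gcongr; exact hCD i j)
    _ = _ := by ring

theorem exists_pair_of_le_max {A : Forms} {x : Plane} {b : ℝ}
    (h : ∀ i j, i ≠ j → b ≤ max |A i x| |A j x|) :
    ∃ i j, i ≠ j ∧ b ≤ |A i x| ∧ b ≤ |A j x| := by
  rcases le_max_iff.1 (h 0 1 (by decide)) with h1 | h1 <;>
  rcases le_max_iff.1 (h 2 3 (by decide)) with h2 | h2 <;>
  exact ⟨_, _, by decide, h1, h2⟩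

/-- The dyadic annulus on which the forms have size about `2 ^ k`. -/
def annulus (A : Forms) (k : ℤ) : Set Plane :=
  {x | (2 : ℝ) ^ k ≤ formSize A x ∧ formSize A x < (2 : ℝ) ^ (k + 1)}

theorem measurableSet_annulus (A : Forms) (k : ℤ) : MeasurableSet (annulus A k) :=
  (measurableSet_le measurable_const (measurable_formSize A)).inter
    (measurableSet_lt (measurable_formSize A) measurable_const)

theorem volume_annulus_le (A : Forms) (k : ℤ) :
    volume (annulus A k) ≤ 4 * ENNReal.ofReal (2 ^ k) ^ 2 * volume (strips A 0 fun _ => 1) := by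
  have h2 : (0 : ℝ) < 2 ^ (k + 1) := by positivity
  have h := volume_strips_smul A 0 (fun _ => 1) h2
  have e : (4 : ℝ≥0∞) * ENNReal.ofReal (2 ^ k) ^ 2 = ENNReal.ofReal ((2 ^ (k + 1)) ^ 2) := by
    rw [← ENNReal.ofReal_pow (by positivity), show (4 : ℝ≥0∞) = ENNReal.ofReal 4 by simp,
      ← ENNReal.ofReal_mul (by norm_num), zpow_add₀ (by norm_num)]
    congr 1
    ring
  rw [e, ← h]
  refine measure_mono fun x hx i => ?_
  have := (abs_le_formSize A x i).trans_lt hx.2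
  simpa using this

theorem ae_mem_iUnion_annulus {A : Forms} (hA : Transversal A) :
    ∀ᵐ x : Plane, x ∈ ⋃ k : ℤ, annulus A k := by
  filter_upwards [(hA.quasiMeasurePreserving 0).ae
    ((Set.countable_singleton (0 : ℝ)).ae_notMem volume)] with x hx
  have h0 : 0 < formSize A x := (abs_pos.2 hx).trans_le (abs_le_formSize A x 0)
  obtain ⟨k, hk⟩ := exists_mem_Ico_zpow h0 (one_lt_two (α := ℝ))
  exact mem_iUnion.2 ⟨k, hk.1, hk.2⟩

theorem tsum_dyadic_le_mass {g : ℝ → ℝ≥0∞} (hg : Antitone g) {c : ℝ} (hc : 0 < c) :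
    ∑' k : ℤ, ENNReal.ofReal (c * 2 ^ (k - 1)) * g (c * 2 ^ k) ≤ mass g := by
  set f : ℤ → ℝ := fun k => c * 2 ^ (k - 1) with hf
  have hf1 : ∀ k, f (Order.succ k) = c * 2 ^ k := fun k => by
    simp only [hf, Order.succ_eq_add_one, add_sub_cancel_right]
  have hf2 : ∀ k, c * 2 ^ k = f k + f k := fun k => by
    simp only [hf, zpow_sub_one₀ (two_ne_zero (α := ℝ))]; ring
  have hf0 : ∀ k, 0 < f k := fun k => by positivity
  have hmono : Monotone f := fun j k hjk => by
    simp only [hf]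
    gcongr
    norm_num
  calc ∑' k : ℤ, ENNReal.ofReal (c * 2 ^ (k - 1)) * g (c * 2 ^ k)
      ≤ ∑' k : ℤ, ∫⁻ u in Ioc (f k) (f (Order.succ k)), 2 * g |u| := by
        refine ENNReal.tsum_le_tsum fun k => ?_
        have : ENNReal.ofReal (c * 2 ^ (k - 1)) * g (c * 2 ^ k) =
            ∫⁻ u in Ioc (f k) (f (Order.succ k)), g (c * 2 ^ k) := by
          rw [setLIntegral_const, Real.volume_Ioc, hf1,
            show c * 2 ^ k - f k = c * 2 ^ (k - 1) by rw [hf2, add_sub_cancel_right], mul_comm]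
        rw [this]
        refine setLIntegral_mono' measurableSet_Ioc fun u hu => ?_
        have h1 : |u| ≤ c * 2 ^ k := by
          rw [abs_of_pos ((hf0 k).trans hu.1), ← hf1]
          exact hu.2
        exact (hg h1).trans (le_mul_of_one_le_left zero_le (by norm_num))
    _ = ∫⁻ u in ⋃ k, Ioc (f k) (f (Order.succ k)), 2 * g |u| :=
        (lintegral_iUnion (fun k => measurableSet_Ioc) hmono.pairwise_disjoint_on_Ioc_succ _).symm
    _ ≤ mass g := setLIntegral_le_lintegral _ _

/-- If the form is small on each dyadic annulus, then it is small. -/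
theorem exists_profileForm_le_of_annulus_le {A B : Forms} (hA : Transversal A)
    (hB : Transversal B) : ∃ K D : ℝ≥0∞, K ≠ ∞ ∧ D ≠ 0 ∧ ∀ g : Fin 4 → ℝ → ℝ≥0∞,
      (∀ i, Antitone (g i)) → ∀ ε : ℝ≥0∞,
      (∀ k, ∫⁻ x in annulus A k, stripVolume B (fun i => g i |A i x|) ≤ D * (ε * ε)) →
      profileForm A B g ≤ K * ε * ∑ i, mass (g i) := by
  obtain ⟨C, hC, hV⟩ := exists_stripVolume_le hB
  obtain ⟨c, hc, hsize⟩ := hA.exists_mul_formSize_le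
  set D : ℝ≥0∞ := C * (4 * volume (strips A 0 fun _ => 1)) + 1 with hD
  have hDt : D ≠ ∞ := by
    have := (volume_strips_lt_top hA 0 fun _ => 1).ne
    simp only [hD]
    finiteness
  refine ⟨D * ENNReal.ofReal (2 / c), D, ENNReal.mul_ne_top hDt ENNReal.ofReal_ne_top, by
    simp [hD], fun g hg ε hε => ?_⟩
  set a : ℤ → ℝ≥0∞ := fun k => ENNReal.ofReal (2 ^ k) * ∑ i, g i (c * 2 ^ k) with ha
  have h1 : ∀ k, ∫⁻ x in annulus A k, stripVolume B (fun i => g i |A i x|) ≤ D * (a k * a k) := by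
    intro k
    calc ∫⁻ x in annulus A k, stripVolume B (fun i => g i |A i x|)
        ≤ ∫⁻ x in annulus A k, C * ((∑ i, g i (c * 2 ^ k)) * ∑ i, g i (c * 2 ^ k)) := by
          refine setLIntegral_mono' (measurableSet_annulus A k) fun x hx => ?_
          have hx1 : c * 2 ^ k ≤ c * formSize A x := by gcongr; exact hx.1
          obtain ⟨i, j, hij, hi, hj⟩ := exists_pair_of_le_max fun i j hij =>
            hx1.trans (hsize x i j hij)
          refine (hV i j hij _).trans ?_
          gcongr
          · exact (hg i hi).trans (Finset.single_le_sum (f := fun i => g i (c * 2 ^ k))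
              (fun _ _ => zero_le) (Finset.mem_univ i))
          · exact (hg j hj).trans (Finset.single_le_sum (f := fun i => g i (c * 2 ^ k))
              (fun _ _ => zero_le) (Finset.mem_univ j))
      _ = C * ((∑ i, g i (c * 2 ^ k)) * ∑ i, g i (c * 2 ^ k)) * volume (annulus A k) :=
          setLIntegral_const _ _
      _ ≤ C * ((∑ i, g i (c * 2 ^ k)) * ∑ i, g i (c * 2 ^ k)) *
          (4 * ENNReal.ofReal (2 ^ k) ^ 2 * volume (strips A 0 fun _ => 1)) := by
          gcongr
          exact volume_annulus_le A k
      _ = C * (4 * volume (strips A 0 fun _ => 1)) * (a k * a k) := by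
          simp only [ha]; ring
      _ ≤ D * (a k * a k) := by gcongr; exact le_self_add
  have h2 : ∀ k, ∫⁻ x in annulus A k, stripVolume B (fun i => g i |A i x|) ≤ D * ε * a k := by
    intro k
    rcases le_total (a k) ε with h | h
    · refine (h1 k).trans ?_
      rw [mul_assoc D ε]
      exact mul_le_mul' le_rfl (mul_le_mul' h le_rfl)
    · refine (hε k).trans ?_
      rw [mul_assoc D ε]
      exact mul_le_mul' le_rfl (mul_le_mul' le_rfl h)
  have h3 : ∑' k, a k ≤ ENNReal.ofReal (2 / c) * ∑ i, mass (g i) := by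
    have e : ∀ k, a k = ENNReal.ofReal (2 / c) *
        ∑ i, ENNReal.ofReal (c * 2 ^ (k - 1)) * g i (c * 2 ^ k) := by
      intro k
      simp only [ha]
      rw [← Finset.mul_sum, ← mul_assoc, ← ENNReal.ofReal_mul (by positivity),
        zpow_sub_one₀ (two_ne_zero (α := ℝ))]
      congr 2
      field_simp
    simp_rw [e]
    rw [ENNReal.tsum_mul_left, Summable.tsum_finsetSum (fun _ _ => ENNReal.summable)]
    gcongr with i
    exact tsum_dyadic_le_mass (hg i) hc
  calc profileForm A B g
      = ∫⁻ x in ⋃ k, annulus A k, stripVolume B (fun i => g i |A i x|) := by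
        rw [Measure.restrict_eq_self_of_ae_mem (ae_mem_iUnion_annulus hA), profileForm]
    _ ≤ ∑' k, ∫⁻ x in annulus A k, stripVolume B (fun i => g i |A i x|) :=
        lintegral_iUnion_le _ _
    _ ≤ ∑' k, D * ε * a k := ENNReal.tsum_le_tsum h2
    _ = D * ε * ∑' k, a k := ENNReal.tsum_mul_left
    _ ≤ D * ε * (ENNReal.ofReal (2 / c) * ∑ i, mass (g i)) := by gcongr
    _ = _ := by ring

/-- The dilation of a profile that preserves its mass. -/
noncomputable def dilate (s : ℝ) (g : ℝ → ℝ≥0∞) (t : ℝ) : ℝ≥0∞ := ENNReal.ofReal s * g (s * t)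

theorem antitone_dilate {g : ℝ → ℝ≥0∞} (hg : Antitone g) {s : ℝ} (hs : 0 < s) :
    Antitone (dilate s g) := fun a b hab => by
  unfold dilate
  gcongr
  exact hg (by gcongr)

theorem mass_dilate (g : ℝ → ℝ≥0∞) {s : ℝ} (hs : 0 < s) : mass (dilate s g) = mass g := by
  rw [mass, mass, lintegral_comp_affine (fun u => 2 * g |u|) hs 0,
    ← lintegral_const_mul' _ _ ENNReal.ofReal_ne_top]
  refine lintegral_congr fun u => ?_
  rw [add_zero, abs_mul, abs_of_pos hs, dilate]
  ring

theorem lintegral_plane_comp_smul (F : Plane → ℝ≥0∞) {s : ℝ} (hs : 0 < s) :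
    ∫⁻ x, F x = ENNReal.ofReal (s ^ 2) * ∫⁻ x, F (s • x) := by
  have h1 := lintegral_map_equiv (μ := (volume : Measure Plane)) F
    (Homeomorph.smulOfNeZero s hs.ne').toMeasurableEquiv
  have h2 := Measure.map_addHaar_smul (volume : Measure Plane) hs.ne'
  have h3 : Measure.map ((Homeomorph.smulOfNeZero s hs.ne').toMeasurableEquiv) volume =
    Measure.map (fun x : Plane => s • x) (volume : Measure Plane) := rfl
  rw [h3, h2, lintegral_smul_measure] at h1
  simp only [Module.finrank_prod, Module.finrank_self] at h1
  have h4 : ∫⁻ x, F (s • x) = _ := h1.symm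
  rw [h4, smul_eq_mul, ← mul_assoc, ← ENNReal.ofReal_mul (by positivity),
    abs_of_pos (by positivity)]
  norm_num
  rw [mul_inv_cancel₀ (by positivity)]
  simp

theorem stripVolume_dilate (A B : Forms) (g : Fin 4 → ℝ → ℝ≥0∞) {s : ℝ} (hs : 0 < s) (x : Plane) :
    stripVolume B (fun i => dilate s (g i) |A i x|) =
      ENNReal.ofReal (s ^ 2) * stripVolume B (fun i => g i |A i (s • x)|) := by
  rw [← stripVolume_smul B _ hs]
  simp only [dilate, map_smul, smul_eq_mul, abs_mul, abs_of_pos hs]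

theorem profileForm_dilate (A B : Forms) (g : Fin 4 → ℝ → ℝ≥0∞) {s : ℝ} (hs : 0 < s) :
    profileForm A B (fun i => dilate s (g i)) = profileForm A B g := by
  rw [profileForm, profileForm,
    lintegral_plane_comp_smul (fun x => stripVolume B fun i => g i |A i x|) hs,
    ← lintegral_const_mul' _ _ ENNReal.ofReal_ne_top]
  simp only [stripVolume_dilate A B g hs]

theorem lintegral_annulus_dilate (A B : Forms) (g : Fin 4 → ℝ → ℝ≥0∞) (k : ℤ) :
    ∫⁻ x in annulus A 0, stripVolume B (fun i => dilate (2 ^ k) (g i) |A i x|) =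
      ∫⁻ x in annulus A k, stripVolume B (fun i => g i |A i x|) := by
  have hs : (0 : ℝ) < 2 ^ k := by positivity
  rw [← lintegral_indicator (measurableSet_annulus A 0),
    ← lintegral_indicator (measurableSet_annulus A k),
    lintegral_plane_comp_smul ((annulus A k).indicator _) hs,
    ← lintegral_const_mul' _ _ ENNReal.ofReal_ne_top]
  refine lintegral_congr fun x => ?_
  have : (2 : ℝ) ^ k • x ∈ annulus A k ↔ x ∈ annulus A 0 := by
    simp only [annulus, mem_ofPred_eq, formSize_smul A hs, zpow_add₀ (two_ne_zero (α := ℝ)),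
      zpow_zero, one_mul, zpow_one]
    rw [le_mul_iff_one_le_right hs, mul_lt_mul_iff_right₀ hs]
  by_cases hx : x ∈ annulus A 0
  · rw [indicator_of_mem hx, indicator_of_mem (this.2 hx), stripVolume_dilate A B g hs]
  · rw [indicator_of_notMem hx, indicator_of_notMem (fun h => hx (this.1 h)), mul_zero]

/-- Helly's selection theorem for a sequence of tuples of decreasing functions. -/
theorem exists_subseq_tendsto_of_antitone {g : ℕ → Fin 4 → ℝ → ℝ≥0∞}
    (hg : ∀ n i, Antitone (g n i)) :
    ∃ φ : ℕ → ℕ, StrictMono φ ∧ ∃ h : Fin 4 → ℝ → ℝ≥0∞, (∀ i, Antitone (h i)) ∧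
      ∀ i, ∀ᵐ t : ℝ, Tendsto (fun n => g (φ n) i t) atTop (𝓝 (h i t)) := by
  obtain ⟨l, φ, hφ, hl⟩ := CompactSpace.tendsto_subseq
    (fun n => (fun p => g n p.1 p.2 : Fin 4 × ℚ → ℝ≥0∞))
  rw [tendsto_pi_nhds] at hl
  set h : Fin 4 → ℝ → ℝ≥0∞ := fun i t => ⨆ (q : ℚ) (_ : t < q), l (i, q) with hh
  have hanti : ∀ i, Antitone (h i) := fun i s t hst =>
    iSup₂_le fun q hq => le_iSup₂_of_le q (hst.trans_lt hq) le_rfl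
  refine ⟨φ, hφ, h, hanti, fun i => ?_⟩
  filter_upwards [((hanti i).countable_not_continuousAt).ae_notMem volume] with t ht
  have hcont : ContinuousAt (h i) t := by simpa using ht
  refine tendsto_order.2 ⟨fun a ha => ?_, fun b hb => ?_⟩
  · obtain ⟨q, hq⟩ := lt_iSup_iff.1 ha
    obtain ⟨htq, hq⟩ := lt_iSup_iff.1 hq
    filter_upwards [(hl (i, q)).eventually_const_lt hq] with n hn
    exact hn.trans_le (hg _ i htq.le)
  · obtain ⟨s, hs, hst⟩ := ((hcont.eventually_lt_const hb).filter_mono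
      nhdsWithin_le_nhds |>.and (self_mem_nhdsWithin (s := Iio t))).exists
    obtain ⟨q, hsq, hqt⟩ := exists_rat_btwn hst
    have hq : l (i, q) < b := (le_iSup₂_of_le q hsq le_rfl : l (i, q) ≤ h i s).trans_lt hs
    filter_upwards [(hl (i, q)).eventually_lt_const hq] with n hn
    exact (hg _ i hqt.le).trans_lt hn

theorem ofReal_mul_le_mass {g : ℝ → ℝ≥0∞} (hg : Antitone g) (t : ℝ) :
    ENNReal.ofReal t * g t ≤ mass g := by
  calc ENNReal.ofReal t * g t = ∫⁻ u in Ioc 0 t, g t := by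
        rw [setLIntegral_const, Real.volume_Ioc, sub_zero, mul_comm]
    _ ≤ ∫⁻ u in Ioc 0 t, 2 * g |u| := by
        refine setLIntegral_mono' measurableSet_Ioc fun u hu => ?_
        rw [abs_of_pos hu.1]
        exact (hg hu.2).trans (le_mul_of_one_le_left zero_le (by norm_num))
    _ ≤ mass g := setLIntegral_le_lintegral _ _

theorem mass_le_liminf {f : ℕ → ℝ → ℝ≥0∞} {h : ℝ → ℝ≥0∞} (hf : ∀ n, Measurable (f n))
    (hlim : ∀ᵐ t : ℝ, Tendsto (fun n => f n |t|) atTop (𝓝 (h |t|))) :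
    mass h ≤ liminf (fun n => mass (f n)) atTop := by
  calc mass h = ∫⁻ u, liminf (fun n => 2 * f n |u|) atTop := by
        refine lintegral_congr_ae ?_
        filter_upwards [hlim] with u hu
        exact (ENNReal.Tendsto.const_mul hu (Or.inr (by simp))).liminf_eq.symm
    _ ≤ _ := lintegral_liminf_le fun n => by have := hf n; fun_prop

theorem ae_comp_abs {p : ℝ → Prop} (h : ∀ᵐ t : ℝ, p t) : ∀ᵐ t : ℝ, p |t| := by
  have h2 : ∀ᵐ t : ℝ, p (-t) := (Measure.measurePreserving_neg volume).quasiMeasurePreserving.ae h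
  filter_upwards [h, h2] with t h1 h2
  rcases abs_choice t with h | h <;> rw [h] <;> assumption

theorem limsup_stripVolume_le {B : Forms} (hB : Transversal B) {r : ℕ → Fin 4 → ℝ≥0∞}
    {s : Fin 4 → ℝ≥0∞} (hs : ∀ i, s i ≠ ∞) (h : ∀ i, Tendsto (fun n => r n i) atTop (𝓝 (s i))) :
    limsup (fun n => stripVolume B (r n)) atTop ≤ stripVolume B s := by
  by_cases h0 : ∃ i, s i = 0
  · obtain ⟨i, hi⟩ := h0
    obtain ⟨j, hij⟩ := exists_index_ne i
    obtain ⟨C, hC, hV⟩ := exists_stripVolume_le hB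
    have h1 : Tendsto (fun n => C * (r n i * r n j)) atTop (𝓝 (C * (s i * s j))) :=
      ENNReal.Tendsto.const_mul (ENNReal.Tendsto.mul (h i) (Or.inr (hs j)) (h j) (Or.inr (hs i)))
        (Or.inr hC)
    calc limsup (fun n => stripVolume B (r n)) atTop
        ≤ limsup (fun n => C * (r n i * r n j)) atTop :=
          limsup_le_limsup (Eventually.of_forall fun n => hV i j hij (r n))
      _ = C * (s i * s j) := h1.limsup_eq
      _ = 0 := by simp [hi]
      _ ≤ _ := zero_le
  · push Not at h0
    refine le_of_forall_le_ofReal_sq_mul fun a ha => ?_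
    rw [← stripVolume_smul B s (by linarith)]
    refine limsup_le_of_le (by isBoundedDefault) ?_
    have : ∀ i, ∀ᶠ n in atTop, r n i < ENNReal.ofReal a * s i := fun i => by
      refine (h i).eventually_lt_const ?_
      conv_lhs => rw [← one_mul (s i)]
      refine (ENNReal.mul_lt_mul_iff_left (h0 i) (hs i)).2 ?_
      rw [← ENNReal.ofReal_one]
      exact (ENNReal.ofReal_lt_ofReal_iff (by linarith)).2 ha
    filter_upwards [eventually_all.2 this] with n hn
    exact stripVolume_mono B fun i => (hn i).le

/-- The points at which the forms are neither all small nor all large. -/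
def midRegion (A : Forms) (M : ℝ) : Set Plane :=
  {x | (∃ i, M⁻¹ ≤ |A i x|) ∧ ∃ i, |A i x| ≤ M}

theorem measurableSet_midRegion (A : Forms) (M : ℝ) : MeasurableSet (midRegion A M) := by
  have : midRegion A M = (⋃ i, {x | M⁻¹ ≤ |A i x|}) ∩ ⋃ i, {x | |A i x| ≤ M} := by
    ext; simp [midRegion]
  rw [this]
  have hm : ∀ i, Measurable fun x => |A i x| := fun i => (measurable_form (A i)).abs
  exact (MeasurableSet.iUnion fun i => measurableSet_le measurable_const (hm i)).inter
    (MeasurableSet.iUnion fun i => measurableSet_le (hm i) measurable_const)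

theorem lintegral_midRegion_lt_top {A : Forms} (hA : Transversal A) {M : ℝ} (hM : 1 ≤ M) :
    ∫⁻ x in midRegion A M, ENNReal.ofReal ((formSize A x ^ 2)⁻¹) < ∞ := by
  have hM0 : 0 < M := by linarith
  have hk : ∀ k, ∫⁻ x in midRegion A M ∩ {x | |A k x| ≤ M},
      ENNReal.ofReal ((formSize A x ^ 2)⁻¹) < ∞ := by
    intro k
    obtain ⟨j, hj⟩ := exists_index_ne k
    obtain ⟨C, hC, h⟩ := exists_lintegral_comp_eq (hA k j hj)
    have hmeas : MeasurableSet (midRegion A M ∩ {x | |A k x| ≤ M}) :=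
      (measurableSet_midRegion A M).inter
        (measurableSet_le (measurable_form (A k)).abs measurable_const)
    calc ∫⁻ x in midRegion A M ∩ {x | |A k x| ≤ M}, ENNReal.ofReal ((formSize A x ^ 2)⁻¹)
        ≤ ∫⁻ x in midRegion A M ∩ {x | |A k x| ≤ M}, (Icc (-M) M).indicator 1 (A k x) *
            ENNReal.ofReal (2 * M ^ 2 * (1 + A j x ^ 2)⁻¹) := by
          refine setLIntegral_mono' hmeas fun x hx => ?_
          rw [indicator_of_mem (show A k x ∈ Icc (-M) M from abs_le.1 hx.2), Pi.one_apply, one_mul]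
          refine ENNReal.ofReal_le_ofReal ?_
          obtain ⟨i, hi⟩ := hx.1.1
          have h1 : M⁻¹ ≤ formSize A x := hi.trans (abs_le_formSize A x i)
          have h2 : |A j x| ≤ formSize A x := abs_le_formSize A x j
          have hMi : 0 < M⁻¹ := by positivity
          have hs : 0 < formSize A x := hMi.trans_le h1
          have h3 : A j x ^ 2 ≤ formSize A x ^ 2 := by rw [← sq_abs]; gcongr
          have h4 : 1 ≤ M * formSize A x := by rwa [inv_le_iff_one_le_mul₀' hM0] at h1
          have h5 : 1 ≤ (M * formSize A x) ^ 2 := one_le_pow₀ h4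
          have h6 : formSize A x ^ 2 ≤ M ^ 2 * formSize A x ^ 2 :=
            le_mul_of_one_le_left (by positivity) (one_le_pow₀ hM)
          rw [inv_le_iff_one_le_mul₀ (by positivity)]
          rw [mul_assoc, mul_comm _ (formSize A x ^ 2), ← mul_assoc, ← div_eq_mul_inv,
            le_div_iff₀ (by positivity)]
          nlinarith
      _ ≤ ∫⁻ x, (Icc (-M) M).indicator 1 (A k x) *
            ENNReal.ofReal (2 * M ^ 2 * (1 + A j x ^ 2)⁻¹) := setLIntegral_le_lintegral _ _
      _ = C * ∫⁻ x : Plane, (Icc (-M) M).indicator 1 x.1 *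
            ENNReal.ofReal (2 * M ^ 2 * (1 + x.2 ^ 2)⁻¹) :=
          h fun x => (Icc (-M) M).indicator 1 x.1 * ENNReal.ofReal (2 * M ^ 2 * (1 + x.2 ^ 2)⁻¹)
      _ = C * ((∫⁻ p : ℝ, (Icc (-M) M).indicator 1 p) *
            ∫⁻ q : ℝ, ENNReal.ofReal (2 * M ^ 2 * (1 + q ^ 2)⁻¹)) := by
          rw [Measure.volume_eq_prod, lintegral_prod_mul
            (f := fun p => (Icc (-M) M).indicator 1 p)
            (g := fun q => ENNReal.ofReal (2 * M ^ 2 * (1 + q ^ 2)⁻¹))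
            ((measurable_one.indicator measurableSet_Icc).aemeasurable) (by fun_prop)]
      _ < ∞ := by
          refine ENNReal.mul_lt_top hC.lt_top (ENNReal.mul_lt_top ?_ ?_)
          · rw [lintegral_indicator_one measurableSet_Icc, Real.volume_Icc]
            exact ENNReal.ofReal_lt_top
          · exact (integrable_inv_one_add_sq.const_mul (2 * M ^ 2)).lintegral_lt_top
  have hcover : midRegion A M = ⋃ k, midRegion A M ∩ {x | |A k x| ≤ M} := by
    ext x
    simp only [mem_iUnion, mem_inter_iff, mem_ofPred_eq, exists_and_left]
    exact ⟨fun hx => ⟨hx, hx.2⟩, fun hx => hx.1⟩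
  rw [hcover]
  refine (lintegral_iUnion_le _ _).trans_lt ?_
  rw [tsum_fintype]
  exact ENNReal.sum_lt_top.2 fun k _ => hk k

/-- Upper semicontinuity of the form away from the origin and from infinity. -/
theorem limsup_lintegral_midRegion_le {A B : Forms} (hA : Transversal A) (hB : Transversal B)
    {f : ℕ → Fin 4 → ℝ → ℝ≥0∞} {h : Fin 4 → ℝ → ℝ≥0∞} (hf : ∀ n i, Antitone (f n i))
    (hh : ∀ i, Measurable (h i)) (hhm : ∀ i, mass (h i) ≠ ∞) {S : ℝ≥0∞} (hS : S ≠ ∞)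
    (hfS : ∀ n i, mass (f n i) ≤ S)
    (hlim : ∀ i, ∀ᵐ t : ℝ, Tendsto (fun n => f n i t) atTop (𝓝 (h i t))) {M : ℝ} (hM : 1 ≤ M) :
    limsup (fun n => ∫⁻ x in midRegion A M, stripVolume B (fun i => f n i |A i x|)) atTop ≤
      profileForm A B h := by
  obtain ⟨C, hC, hV⟩ := exists_stripVolume_le hB
  obtain ⟨c, hc, hsize⟩ := hA.exists_mul_formSize_le
  have hM0 : 0 < M := by linarith
  set b : ℝ≥0∞ := C * (S * S * ENNReal.ofReal ((c ^ 2)⁻¹)) with hb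
  have hbt : b ≠ ∞ := by simp only [hb]; finiteness
  have hbound : ∀ n, (fun x => stripVolume B (fun i => f n i |A i x|))
      ≤ᵐ[volume.restrict (midRegion A M)]
      fun x => b * ENNReal.ofReal ((formSize A x ^ 2)⁻¹) := by
    intro n
    refine (ae_restrict_iff' (measurableSet_midRegion A M)).2 (Eventually.of_forall fun x hx => ?_)
    obtain ⟨i₀, hi₀⟩ := hx.1
    have hs : 0 < formSize A x :=
      (inv_pos.2 hM0).trans_le (hi₀.trans (abs_le_formSize A x i₀))
    have hcs : 0 < c * formSize A x := by positivity
    have hone : ∀ i, c * formSize A x ≤ |A i x| →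
        f n i |A i x| ≤ S * ENNReal.ofReal ((c * formSize A x)⁻¹) := by
      intro i hi
      have h1 := (ofReal_mul_le_mass (hf n i) (c * formSize A x)).trans (hfS n i)
      rw [ENNReal.ofReal_inv_of_pos hcs, ← div_eq_mul_inv,
        ENNReal.le_div_iff_mul_le (Or.inl (by simpa using hcs)) (Or.inl ENNReal.ofReal_ne_top),
        mul_comm]
      exact (mul_le_mul' le_rfl (hf n i hi)).trans h1
    obtain ⟨i, j, hij, hi, hj⟩ := exists_pair_of_le_max (hsize x)
    calc stripVolume B (fun i => f n i |A i x|)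
        ≤ C * (f n i |A i x| * f n j |A j x|) := hV i j hij _
      _ ≤ C * ((S * ENNReal.ofReal ((c * formSize A x)⁻¹)) *
            (S * ENNReal.ofReal ((c * formSize A x)⁻¹))) := by
          gcongr
          · exact hone i hi
          · exact hone j hj
      _ = C * (S * S * (ENNReal.ofReal ((c * formSize A x)⁻¹) *
            ENNReal.ofReal ((c * formSize A x)⁻¹))) := by ring
      _ = b * ENNReal.ofReal ((formSize A x ^ 2)⁻¹) := by
          have e : ENNReal.ofReal ((c * formSize A x)⁻¹) * ENNReal.ofReal ((c * formSize A x)⁻¹) =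
              ENNReal.ofReal ((c ^ 2)⁻¹) * ENNReal.ofReal ((formSize A x ^ 2)⁻¹) := by
            rw [← ENNReal.ofReal_mul (by positivity), ← ENNReal.ofReal_mul (by positivity),
              ← mul_inv, ← mul_inv]
            congr 2
            ring
          rw [e, hb]
          ring
  have hfin : ∫⁻ x in midRegion A M, b * ENNReal.ofReal ((formSize A x ^ 2)⁻¹) ≠ ∞ := by
    rw [lintegral_const_mul' _ _ hbt]
    exact ENNReal.mul_ne_top hbt (lintegral_midRegion_lt_top hA hM).ne
  have key := limsup_lintegral_le (μ := volume.restrict (midRegion A M))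
    (f := fun n x => stripVolume B (fun i => f n i |A i x|)) _
    (fun n => measurable_stripVolume A B fun i => (hf n i).measurable) hbound hfin
  refine key.trans ((setLIntegral_le_lintegral _ _).trans (lintegral_mono_ae ?_))
  have hlimA : ∀ᵐ x : Plane, ∀ i, Tendsto (fun n => f n i |A i x|) atTop (𝓝 (h i |A i x|)) :=
    ae_all_iff.2 fun i => (hA.quasiMeasurePreserving i).ae (ae_comp_abs (hlim i))
  filter_upwards [hlimA, ae_ne_top_of_mass hA hh hhm] with x h1 h2
  exact limsup_stripVolume_le hB h2 h1

theorem annulus_zero_subset_midRegion (A : Forms) : annulus A 0 ⊆ midRegion A 2 := by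
  intro x hx
  simp only [annulus, zpow_zero, zero_add, zpow_one, mem_ofPred_eq] at hx
  constructor
  · by_contra! hc
    have := (formSize_lt_iff A x (by norm_num : (0 : ℝ) < 2⁻¹)).2 hc
    linarith [hx.1]
  · exact ⟨0, (abs_le_formSize A x 0).trans hx.2.le⟩

theorem profileForm_le_midRegion_add (A B : Forms) (g : Fin 4 → ℝ → ℝ≥0∞) (M : ℝ) :
    profileForm A B g ≤ (∫⁻ x in midRegion A M, stripVolume B (fun i => g i |A i x|)) +
      profileForm A B (fun i => (Icc M⁻¹ M)ᶜ.indicator (g i)) := by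
  rw [profileForm, ← lintegral_add_compl _ (measurableSet_midRegion A M)]
  gcongr
  refine (setLIntegral_mono' (measurableSet_midRegion A M).compl fun x hx => ?_).trans
    (setLIntegral_le_lintegral _ _)
  refine stripVolume_mono B fun i => ?_
  have hmem : |A i x| ∈ (Icc M⁻¹ M)ᶜ := fun hi => hx ⟨⟨i, hi.1⟩, ⟨i, hi.2⟩⟩
  exact (indicator_of_mem hmem (g i)).ge

theorem mass_indicator_add_compl {g : ℝ → ℝ≥0∞} (hg : Measurable g) {s : Set ℝ}
    (hs : MeasurableSet s) : mass (s.indicator g) + mass (sᶜ.indicator g) = mass g := by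
  rw [← mass_add (hg.indicator hs)]
  congr 1
  exact indicator_self_add_compl s g

theorem tendsto_mass_indicator {g : ℝ → ℝ≥0∞} (hg : Measurable g) :
    Tendsto (fun n : ℕ => mass ((Icc ((n : ℝ) + 1)⁻¹ (n + 1)).indicator g)) atTop
      (𝓝 (mass g)) := by
  have hm : Monotone fun n : ℕ => Icc ((n : ℝ) + 1)⁻¹ (n + 1) := fun m n hmn => by
    have : (m : ℝ) ≤ n := by exact_mod_cast hmn
    exact Icc_subset_Icc (by gcongr) (by linarith)
  refine lintegral_tendsto_of_tendsto_of_monotone (fun n => ?_) (Eventually.of_forall fun u => ?_) ?_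
  · have : Measurable ((Icc ((n : ℝ) + 1)⁻¹ (n + 1)).indicator g) := hg.indicator measurableSet_Icc
    fun_prop
  · intro m n hmn
    have := indicator_le_indicator_of_subset (hm hmn) (fun _ => zero_le) (f := g) |u|
    simp only
    gcongr
  · filter_upwards [(Set.countable_singleton (0 : ℝ)).ae_notMem volume] with u hu
    have hpos : 0 < |u| := abs_pos.2 hu
    refine tendsto_const_nhds.congr' ?_
    filter_upwards [eventually_ge_atTop ⌈|u|⌉₊, eventually_ge_atTop ⌈|u|⁻¹⌉₊] with n h1 h2
    have h1 := Nat.ceil_le.1 h1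
    have h2 := Nat.ceil_le.1 h2
    rw [indicator_of_mem]
    exact ⟨inv_le_of_inv_le₀ hpos (by linarith), by linarith⟩

theorem eventually_le_add_of_le_liminf {u : ℕ → ℝ≥0∞} {a δ : ℝ≥0∞} (ha : a ≠ ∞) (hδ : δ ≠ 0)
    (h : a ≤ liminf u atTop) : ∀ᶠ n in atTop, a ≤ u n + δ := by
  rcases eq_or_ne a 0 with rfl | h0
  · simp
  · filter_upwards [eventually_lt_of_lt_liminf ((ENNReal.sub_lt_self ha h0 hδ).trans_le h)] with n hn
    exact tsub_le_iff_right.1 hn.le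

/-- The upper regularization of `supForm`. -/
noncomputable def supFormBar (A B : Forms) (m : Fin 4 → ℝ≥0∞) : ℝ≥0∞ :=
  ⨅ (η : ℝ≥0∞) (_ : η ≠ 0), supForm A B (fun i => m i + η)

theorem supForm_le_supFormBar (A B : Forms) (m : Fin 4 → ℝ≥0∞) :
    supForm A B m ≤ supFormBar A B m :=
  le_iInf₂ fun _ _ => supForm_mono A B fun _ => le_self_add

theorem supFormBar_le (A B : Forms) (m : Fin 4 → ℝ≥0∞) {η : ℝ≥0∞} (hη : η ≠ 0) :
    supFormBar A B m ≤ supForm A B (fun i => m i + η) :=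
  iInf₂_le η hη

theorem supFormBar_ne_top {A B : Forms} (hA : Transversal A) (hB : Transversal B)
    {m : Fin 4 → ℝ≥0∞} (hm : ∀ i, m i ≠ ∞) : supFormBar A B m ≠ ∞ :=
  ((supFormBar_le A B m one_ne_zero).trans_lt
    (supForm_ne_top hA hB fun i => ENNReal.add_ne_top.2 ⟨hm i, by simp⟩).lt_top).ne

theorem profileForm_add_supFormBar_le {A B : Forms} (hA : Transversal A) (hB : Transversal B)
    {g : Fin 4 → ℝ → ℝ≥0∞} (hg : ∀ i, Measurable (g i)) {m m' : Fin 4 → ℝ≥0∞}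
    (hm : ∀ i, m i ≠ ∞) (h : ∀ i, mass (g i) + m' i ≤ m i) :
    profileForm A B g + supFormBar A B m' ≤ supFormBar A B m := by
  refine le_iInf₂ fun η hη => ?_
  have hη' : min η 1 ≠ 0 := by simp [hη]
  have hfin : min η 1 ≠ ∞ := ((min_le_right η 1).trans_lt ENNReal.one_lt_top).ne
  have hgm : ∀ i, mass (g i) ≠ ∞ := fun i => ((le_self_add.trans (h i)).trans_lt (hm i).lt_top).ne
  have hm' : ∀ i, m' i ≠ ∞ := fun i => ((le_add_self.trans (h i)).trans_lt (hm i).lt_top).ne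
  refine (add_le_add (profileForm_le_supForm A B hg fun _ => le_rfl)
    (supFormBar_le A B m' hη')).trans ((supForm_add_le hA hB hgm
      fun i => ENNReal.add_ne_top.2 ⟨hm' i, hfin⟩).trans (supForm_mono A B fun i => ?_))
  rw [← add_assoc]
  exact add_le_add (h i) (min_le_left _ _)

/-- Near-maximizing profiles whose form is concentrated on the unit annulus. -/
theorem exists_near_maximizers {A B : Forms} (hA : Transversal A) (hB : Transversal B)
    {m : Fin 4 → ℝ≥0∞} (hm : ∀ i, m i ≠ ∞) (h0 : supFormBar A B m ≠ 0) :
    ∃ κ : ℝ≥0∞, κ ≠ 0 ∧ ∀ η : ℝ≥0∞, η ≠ 0 → η ≤ 1 → ∃ g : Fin 4 → ℝ → ℝ≥0∞,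
      (∀ i, Antitone (g i)) ∧ (∀ i, mass (g i) ≤ m i + η) ∧
      supFormBar A B m ≤ profileForm A B g + η ∧
      κ ≤ ∫⁻ x in annulus A 0, stripVolume B (fun i => g i |A i x|) := by
  obtain ⟨K, D, hK, hD, hnv⟩ := exists_profileForm_le_of_annulus_le hA hB
  have htop := supFormBar_ne_top hA hB hm
  set θ := supFormBar A B m with hθ
  set S : ℝ≥0∞ := ∑ i, (m i + 1) with hS
  have hSt : S ≠ ∞ := by
    rw [hS]
    exact ENNReal.sum_ne_top.2 fun i _ => ENNReal.add_ne_top.2 ⟨hm i, by simp⟩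
  have hKS : K * S + 1 ≠ ∞ := by finiteness
  set ε : ℝ≥0∞ := θ / 2 / (K * S + 1) with hε
  have hε0 : ε ≠ 0 := ENNReal.div_ne_zero.2 ⟨ENNReal.div_ne_zero.2 ⟨h0, by simp⟩, hKS⟩
  refine ⟨D * (ε * ε), mul_ne_zero hD (mul_ne_zero hε0 hε0), fun η hη hη1 => ?_⟩
  have hlt : max (θ - η) (θ / 2) < supForm A B (fun i => m i + η) :=
    (max_lt (ENNReal.sub_lt_self htop h0 hη) (ENNReal.half_lt_self h0 htop)).trans_le
      (supFormBar_le A B m hη)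
  obtain ⟨g, hg⟩ := lt_iSup_iff.1 hlt
  obtain ⟨⟨hgM, hgm⟩, hg⟩ := lt_iSup_iff.1 hg
  obtain ⟨g', hg'a, hg'm, hg'⟩ := exists_antitone_profileForm_le hA hB hgM
  have hlt' := hg.trans_le hg'
  have hmass : ∀ i, mass (g' i) ≤ m i + η := fun i => (hg'm i).trans_le (hgm i)
  obtain ⟨k, hk⟩ : ∃ k, D * (ε * ε) < ∫⁻ x in annulus A k, stripVolume B (fun i => g' i |A i x|) := by
    by_contra! hc
    have h1 := hnv g' hg'a ε hc
    have h2 : K * ε * ∑ i, mass (g' i) ≤ θ / 2 := by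
      calc K * ε * ∑ i, mass (g' i) ≤ K * ε * S := by
            exact mul_le_mul' le_rfl
              (Finset.sum_le_sum fun i _ => (hmass i).trans (add_le_add le_rfl hη1))
        _ = ε * (K * S) := by ring
        _ ≤ ε * (K * S + 1) := by gcongr; exact le_self_add
        _ = θ / 2 := ENNReal.div_mul_cancel (by simp) hKS
    exact absurd ((le_max_right _ _).trans_lt hlt') (not_lt.2 (h1.trans h2))
  have h2k : (0 : ℝ) < 2 ^ k := by positivity
  refine ⟨fun i => dilate (2 ^ k) (g' i), fun i => antitone_dilate (hg'a i) h2k, fun i => ?_, ?_, ?_⟩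
  · rw [mass_dilate _ h2k]
    exact hmass i
  · rw [profileForm_dilate A B g' h2k]
    exact tsub_le_iff_right.1 ((le_max_left _ _).trans hlt'.le)
  · rw [lintegral_annulus_dilate]
    exact hk.le

/-- A nontrivial profile splits off from every maximizing sequence. -/
theorem exists_profile_splitting {A B : Forms} (hA : Transversal A) (hB : Transversal B)
    {m : Fin 4 → ℝ≥0∞} (hm : ∀ i, m i ≠ ∞) (h0 : supFormBar A B m ≠ 0) :
    ∃ h : Fin 4 → ℝ → ℝ≥0∞, (∀ i, Antitone (h i)) ∧ (∀ i, mass (h i) ≤ m i) ∧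
      profileForm A B h ≠ 0 ∧
      supFormBar A B m ≤ profileForm A B h + supFormBar A B (fun i => m i - mass (h i)) := by
  obtain ⟨κ, hκ, hnear⟩ := exists_near_maximizers hA hB hm h0
  set η : ℕ → ℝ≥0∞ := fun n => ((n : ℝ≥0∞) + 1)⁻¹ with hη
  have hη0 : ∀ n, η n ≠ 0 := fun n => ENNReal.inv_ne_zero.2 (by finiteness)
  have hη1 : ∀ n, η n ≤ 1 := fun n => ENNReal.inv_le_one.2 le_add_self
  have hηlim : Tendsto η atTop (𝓝 0) := by
    have := (tendsto_add_atTop_iff_nat (f := fun n : ℕ => ((n : ℝ≥0∞))⁻¹) 1).2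
      ENNReal.tendsto_inv_nat_nhds_zero
    simpa [hη] using this
  choose g hga hgm hgθ hgκ using fun n => hnear (η n) (hη0 n) (hη1 n)
  obtain ⟨φ, hφ, h, hh, hlim⟩ := exists_subseq_tendsto_of_antitone hga
  have hηφ : Tendsto (fun n => η (φ n)) atTop (𝓝 0) := hηlim.comp hφ.tendsto_atTop
  have hmh : ∀ i, mass (h i) ≤ m i := by
    intro i
    refine (mass_le_liminf (fun n => (hga (φ n) i).measurable) (ae_comp_abs (hlim i))).trans ?_
    have h1 : Tendsto (fun n => m i + η (φ n)) atTop (𝓝 (m i + 0)) := hηφ.const_add (m i)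
    rw [add_zero] at h1
    exact (liminf_le_liminf (Eventually.of_forall fun n => hgm (φ n) i)).trans h1.liminf_eq.le
  have hmt : ∀ i, mass (h i) ≠ ∞ := fun i => ((hmh i).trans_lt (hm i).lt_top).ne
  set S : ℝ≥0∞ := ∑ i, (m i + 1) with hS
  have hSt : S ≠ ∞ := ENNReal.sum_ne_top.2 fun i _ => ENNReal.add_ne_top.2 ⟨hm i, by simp⟩
  have hgS : ∀ n i, mass (g (φ n) i) ≤ S := fun n i =>
    ((hgm _ i).trans (by gcongr; exact hη1 _)).trans
      (Finset.single_le_sum (f := fun i => m i + 1) (fun _ _ => zero_le) (Finset.mem_univ i))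
  have hmid : ∀ {M : ℝ}, 1 ≤ M → limsup (fun n => ∫⁻ x in midRegion A M,
      stripVolume B (fun i => g (φ n) i |A i x|)) atTop ≤ profileForm A B h := fun {M} hM =>
    limsup_lintegral_midRegion_le hA hB (fun n => hga (φ n)) (fun i => (hh i).measurable) hmt hSt
      hgS hlim hM
  refine ⟨h, hh, hmh, ?_, ?_⟩
  · have h1 : κ ≤ profileForm A B h := by
      refine le_trans ?_ (hmid (M := 2) (by norm_num))
      refine le_limsup_of_frequently_le (Frequently.of_forall fun n => ?_) (by isBoundedDefault)
      exact (hgκ (φ n)).trans (lintegral_mono_set (annulus_zero_subset_midRegion A))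
    exact fun h2 => hκ (le_antisymm (h1.trans h2.le) zero_le)
  · rw [← tsub_le_iff_left]
    refine le_iInf₂ fun δ hδ => ?_
    rw [tsub_le_iff_left]
    refine ENNReal.le_of_forall_pos_le_add fun δ' hδ' _ => ?_
    have hδ4 : δ / 4 ≠ 0 := ENNReal.div_ne_zero.2 ⟨hδ, by simp⟩
    have hδ2 : (δ' : ℝ≥0∞) / 2 ≠ 0 := ENNReal.div_ne_zero.2 ⟨by simpa using hδ'.ne', by simp⟩
    obtain ⟨N, hN⟩ : ∃ N : ℕ, ∀ i, mass (h i) ≤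
        mass ((Icc ((N : ℝ) + 1)⁻¹ (N + 1)).indicator (h i)) + δ / 4 :=
      (eventually_all.2 fun i => eventually_le_add_of_le_liminf (hmt i) hδ4
        (tendsto_mass_indicator (hh i).measurable).liminf_eq.ge).exists
    set I : Set ℝ := Icc ((N : ℝ) + 1)⁻¹ (N + 1) with hI
    have hIm : MeasurableSet I := measurableSet_Icc
    have hinner : ∀ i, ∀ᶠ n in atTop, mass (I.indicator (h i)) ≤
        mass (I.indicator (g (φ n) i)) + δ / 4 := fun i => by
      refine eventually_le_add_of_le_liminf ?_ hδ4 (mass_le_liminf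
        (fun n => (hga (φ n) i).measurable.indicator hIm) ?_)
      · refine ((?_ : _ ≤ mass (h i)).trans_lt (hmt i).lt_top).ne
        rw [← mass_indicator_add_compl (hh i).measurable hIm]
        exact le_self_add
      · filter_upwards [ae_comp_abs (hlim i)] with u hu
        by_cases huI : |u| ∈ I
        · simpa only [indicator_of_mem huI] using hu
        · simpa only [indicator_of_notMem huI] using tendsto_const_nhds
    have hΦt : profileForm A B h ≠ ∞ :=
      ((profileForm_le_supForm A B (fun i => (hh i).measurable) fun _ => le_rfl).trans_lt
        (supForm_ne_top hA hB hmt).lt_top).ne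
    have hNM : (1 : ℝ) ≤ N + 1 := by
      have : (0 : ℝ) ≤ N := Nat.cast_nonneg N
      linarith
    obtain ⟨n, hn1, hn2, hn3, hn4⟩ := ((eventually_all.2 hinner).and
      ((eventually_lt_of_limsup_lt ((hmid hNM).trans_lt (ENNReal.lt_add_right hΦt hδ2))).and
      ((hηφ.eventually_lt_const (pos_iff_ne_zero.2 hδ4)).and
        (hηφ.eventually_lt_const (pos_iff_ne_zero.2 hδ2))))).exists
    have hout : ∀ i, mass (Iᶜ.indicator (g (φ n) i)) ≤ m i - mass (h i) + δ := by
      intro i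
      have e := mass_indicator_add_compl (hga (φ n) i).measurable hIm
      refine (ENNReal.add_le_add_iff_right (hmt i)).1 ?_
      calc mass (Iᶜ.indicator (g (φ n) i)) + mass (h i)
          ≤ mass (Iᶜ.indicator (g (φ n) i)) +
              (mass (I.indicator (g (φ n) i)) + δ / 4 + δ / 4) := by
            gcongr
            exact (hN i).trans (by gcongr; exact hn1 i)
        _ = mass (g (φ n) i) + (δ / 4 + δ / 4) := by rw [← e]; ring
        _ ≤ m i + δ / 4 + (δ / 4 + δ / 4) := by
            gcongr
            exact (hgm (φ n) i).trans (by gcongr)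
        _ ≤ m i + (δ / 4 + δ / 4 + (δ / 4 + δ / 4)) := by
            rw [add_assoc]
            gcongr
            exact le_self_add
        _ = m i + δ := by
            congr 1
            rw [show δ / 4 + δ / 4 + (δ / 4 + δ / 4) = 4 * (δ / 4) by ring]
            exact ENNReal.mul_div_cancel (by simp) (by simp)
        _ = m i - mass (h i) + δ + mass (h i) := by
            rw [add_right_comm, tsub_add_cancel_of_le (hmh i)]
    calc supFormBar A B m ≤ profileForm A B (g (φ n)) + η (φ n) := hgθ (φ n)
      _ ≤ (∫⁻ x in midRegion A (N + 1), stripVolume B (fun i => g (φ n) i |A i x|)) +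
            profileForm A B (fun i => Iᶜ.indicator (g (φ n) i)) + η (φ n) := by
          gcongr
          exact profileForm_le_midRegion_add A B _ _
      _ ≤ (profileForm A B h + δ' / 2) + supForm A B (fun i => m i - mass (h i) + δ) +
            δ' / 2 := by
          gcongr
          exact profileForm_le_supForm A B
            (fun i => (hga (φ n) i).measurable.indicator hIm.compl) hout
      _ = profileForm A B h + supForm A B (fun i => m i - mass (h i) + δ) +
            (δ' / 2 + δ' / 2) := by ring
      _ = _ := by rw [ENNReal.add_halves]

/-- Existence of maximizing profiles. -/
theorem exists_maximizing_profile {A B : Forms} (hA : Transversal A) (hB : Transversal B)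
    {m : Fin 4 → ℝ≥0∞} (hm : ∀ i, m i ≠ ∞) (h0 : supForm A B m ≠ 0) :
    ∃ g : Fin 4 → ℝ → ℝ≥0∞, (∀ i, Measurable (g i)) ∧ (∀ i, mass (g i) = m i) ∧
      supForm A B m ≤ profileForm A B g := by
  have h0' : supFormBar A B m ≠ 0 := fun h =>
    h0 (le_antisymm ((supForm_le_supFormBar A B m).trans h.le) zero_le)
  obtain ⟨g, hg, hgm, hg0, hgle⟩ := exists_profile_splitting hA hB hm h0'
  have hgt : ∀ i, mass (g i) ≠ ∞ := fun i => ((hgm i).trans_lt (hm i).lt_top).ne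
  have hm' : ∀ i, m i - mass (g i) ≠ ∞ := fun i => ENNReal.sub_ne_top (hm i)
  have hrest : supFormBar A B (fun i => m i - mass (g i)) = 0 := by
    by_contra hne
    obtain ⟨h, hh, hhm, hh0, hhle⟩ := exists_profile_splitting hA hB hm' hne
    have hht : ∀ i, mass (h i) ≠ ∞ := fun i => ((hhm i).trans_lt (hm' i).lt_top).ne
    have hlt := profileForm_add_lt hA hB hg hh hgt hht hg0 hh0
    have hle := profileForm_add_supFormBar_le hA hB (g := fun i t => g i t + h i t)
      (m' := fun i => m i - mass (g i) - mass (h i)) (fun i => (hg i).measurable.add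
        (hh i).measurable) hm fun i => by
      rw [mass_add (hg i).measurable, add_assoc, add_tsub_cancel_of_le (hhm i),
        add_tsub_cancel_of_le (hgm i)]
    have hfin : supFormBar A B (fun i => m i - mass (g i) - mass (h i)) ≠ ∞ :=
      supFormBar_ne_top hA hB fun i => ENNReal.sub_ne_top (hm' i)
    refine absurd (hgle.trans (add_le_add le_rfl hhle)) (not_le.2 ?_)
    rw [← add_assoc]
    exact (ENNReal.add_lt_add_right hfin hlt).trans_le hle
  rw [hrest, add_zero] at hgle
  have hmass0 : ∀ i, mass (g i) ≠ 0 := fun i =>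
    mass_ne_zero_of_profileForm_ne_zero hA (fun i => (hg i).measurable) hg0 i
  refine ⟨fun i t => m i / mass (g i) * g i t, fun i => (hg i).measurable.const_mul _,
    fun i => ?_, ?_⟩
  · rw [mass_const_mul (hg i).measurable, ENNReal.div_mul_cancel (hmass0 i) (hgt i)]
  · refine ((supForm_le_supFormBar A B m).trans hgle).trans (lintegral_mono fun x => ?_)
    refine stripVolume_mono B fun i => le_mul_of_one_le_left zero_le ?_
    rw [ENNReal.le_div_iff_mul_le (Or.inl (hmass0 i)) (Or.inl (hgt i)), one_mul]
    exact hgm i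

theorem Lam_eq_incidence {L : Tuple} {A B : Forms} (hL : ∀ i x y, L i (x, y) = (A i x, B i y))
    {E : Fin 4 → Set Plane} (hE : ∀ i, MeasurableSet (E i)) : Lam L E = incidence A B E := by
  rw [incidence, ← lintegral_indicator_one (measurableSet_incidence A B hE), Lam]
  refine lintegral_congr fun z => ?_
  have hz : ∀ i, L i z = (A i z.1, B i z.2) := fun i => hL i z.1 z.2
  by_cases h : ∀ i, (A i z.1, B i z.2) ∈ E i
  · rw [indicator_of_mem (show z ∈ {z : Space4 | ∀ i, (A i z.1, B i z.2) ∈ E i} from h)]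
    exact Finset.prod_eq_one fun i _ => by rw [hz, indicator_of_mem (h i)]
  · rw [indicator_of_notMem (show z ∉ {z : Space4 | ∀ i, (A i z.1, B i z.2) ∈ E i} from h)]
    push Not at h
    obtain ⟨i, hi⟩ := h
    exact Finset.prod_eq_zero (Finset.mem_univ i) (by rw [hz, indicator_of_notMem hi])

theorem Lam_mono (L : Tuple) {E F : Fin 4 → Set Plane} (h : ∀ i, E i ⊆ F i) :
    Lam L E ≤ Lam L F :=
  lintegral_mono fun _ => Finset.prod_le_prod' fun i _ =>
    indicator_le_indicator_of_subset (h i) (fun _ => zero_le) _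

end PartialSymm

open PartialSymm in
theorem theorem4p1 (L : PartialSymm.Tuple) (hsymm : PartialSymm.PartialSymmetry L)
    (hnondeg : PartialSymm.Nondegenerate L) (e : Fin 4 → ℝ) (he : ∀ i, 0 < e i) :
    PartialSymm.Theta L e < ⊤ ∧
      ∃ E : Fin 4 → Set PartialSymm.Plane,
        PartialSymm.HasMeasures E e ∧ PartialSymm.Lam L E = PartialSymm.Theta L e := by
  set A : Forms := comp1 L with hAdef
  set B : Forms := comp2 L with hBdef
  have hL : ∀ i x y, L i (x, y) = (A i x, B i y) := by
    intro i x y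
    obtain ⟨a, b, -, -, h⟩ := hsymm i
    obtain ⟨h1, h2⟩ := comp_eq h
    rw [h x y, hAdef, hBdef, h1, h2]
  have hA : Transversal A := fun i j hij => (hnondeg i j hij).1
  have hB : Transversal B := fun i j hij => (hnondeg i j hij).2
  set m : Fin 4 → ℝ≥0∞ := fun i => ENNReal.ofReal (e i) with hmdef
  have hm : ∀ i, m i ≠ ∞ := fun i => ENNReal.ofReal_ne_top
  have hle : Theta L e ≤ supForm A B m := by
    refine iSup₂_le fun E hE => ?_
    calc Lam L E ≤ Lam L (fun i => toMeasurable volume (E i)) :=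
          Lam_mono L fun i => subset_toMeasurable _ _
      _ = incidence A B (fun i => toMeasurable volume (E i)) :=
          Lam_eq_incidence hL fun i => measurableSet_toMeasurable _ _
      _ ≤ supForm A B (fun i => volume (toMeasurable volume (E i))) :=
          incidence_le_supForm hA hB fun i => measurableSet_toMeasurable _ _
      _ ≤ supForm A B m := supForm_mono A B fun i => by
          rw [measure_toMeasurable, (hE i).2]
  refine ⟨hle.trans_lt (supForm_ne_top hA hB hm).lt_top, ?_⟩
  suffices h : ∃ E : Fin 4 → Set Plane, HasMeasures E e ∧ Theta L e ≤ Lam L E by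
    obtain ⟨E, hE, hEle⟩ := h
    exact ⟨E, hE, le_antisymm (le_iSup₂_of_le E hE le_rfl) hEle⟩
  by_cases h0 : supForm A B m = 0
  · refine ⟨fun i => Set.Ioo 0 (e i) ×ˢ Set.Ioo 0 1, fun i => ⟨?_, ?_⟩, ?_⟩
    · exact (measurableSet_Ioo.prod measurableSet_Ioo).nullMeasurableSet
    · rw [Measure.volume_eq_prod, Measure.prod_prod]
      simp
    · exact (hle.trans h0.le).trans zero_le
  · obtain ⟨g, hg, hgm, hgle⟩ := exists_maximizing_profile hA hB hm h0
    refine ⟨fun i => body (g i), fun i => ⟨(measurableSet_body (hg i)).nullMeasurableSet, ?_⟩, ?_⟩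
    · rw [volume_body (hg i), hgm i]
    · rw [Lam_eq_incidence hL fun i => measurableSet_body (hg i), incidence_body A B hg]
      exact hle.trans hgle
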